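/- Let $\mathcal Z$ be a complex Hilbert space, let $A$ with domain $D(A)\subset\mathcal Z$ be skew-adjoint ($D(A)$ is dense and $A^*=-A$, including equality of domains), so that $A$ generates a $C_0$-semigroup, and let $B:\mathbb C\to\mathcal Z$ be a non-zero bounded linear operator, i.e. $Bu=bu$ and $B^*x=\langle x,b\rangle$ for some $b\in\mathcal Z\setminus\{0\}$. Assume that the spectrum $\sigma(A)$ is non-empty and consists only of isolated eigenvalues with finite algebraic multiplicity. Assume further that the collocated system $\Sigma(A,B,B^*)$ is minimal, that is, no $\lambda\in\sigma(A)$ is an invariant zero, where $\lambda\in\mathbb C$ is called an invariant zero if there are $x\in D(A)\setminus\{0\}$ and $u\in\mathbb C$ with $(\lambda I-A)x-Bu=0$ and $B^*x=0$. Then for every $k>0$ the operator $A-kBB^*$ with domain $D(A)$ generates a $C_0$-semigroup, and the semigroup $(T_k(t))_{t\ge0}$ it generates is a contraction semigroup ($\|T_k(t)\|\le 1$ for all $t\ge 0$) and is strongly stable: $\lim_{t\to\infty}\|T_k(t)z\|=0$ for every $z\in\mathcal Z$. -/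

import Mathlib

open Filter Topology
open scoped NNReal

namespace RootLocus

section

variable {Z : Type*} [NormedAddCommGroup Z] [InnerProductSpace ℂ Z]

/-- A strongly continuous (`C₀`-) semigroup of bounded linear operators on `Z`. -/
structure C0Semigroup (Z : Type*) [NormedAddCommGroup Z] [InnerProductSpace ℂ Z] where
  toFun : ℝ≥0 → Z →L[ℂ] Z
  map_zero : toFun 0 = ContinuousLinearMap.id ℂ Z
  map_add : ∀ s t, toFun (s + t) = (toFun s).comp (toFun t)
  tendsto_zero : ∀ z, Tendsto (fun t => toFun t z) (𝓝 0) (𝓝 z)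

/-- `A` is the (infinitesimal) generator of `T`: one has `x ∈ D(A)` and `A x = y` if and only if
`(T(h) x - x) / h → y` as `h ↓ 0`. -/
def C0Semigroup.IsGenerator (T : C0Semigroup Z) (A : Z →ₗ.[ℂ] Z) : Prop :=
  ∀ x y : Z, (∃ hx : x ∈ A.domain, A ⟨x, hx⟩ = y) ↔
    Tendsto (fun h : ℝ≥0 => (((h : ℝ) : ℂ))⁻¹ • (T.toFun h x - x)) (𝓝[>] 0) (𝓝 y)

/-- A contraction semigroup. -/
def C0Semigroup.IsContraction (T : C0Semigroup Z) : Prop :=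
  ∀ t, ‖T.toFun t‖ ≤ 1

/-- Strong stability: every orbit tends to zero in norm. -/
def C0Semigroup.IsStronglyStable (T : C0Semigroup Z) : Prop :=
  ∀ z, Tendsto (fun t => T.toFun t z) atTop (𝓝 0)

/-- The resolvent set of `A`: all `s` for which `s I - A : D(A) → Z` has a bounded two-sided
inverse. -/
def resolventSet (A : Z →ₗ.[ℂ] Z) : Set ℂ :=
  {s | ∃ R : Z →L[ℂ] Z, (∀ x : A.domain, R (s • (x : Z) - A x) = x) ∧
    ∀ z : Z, ∃ hz : R z ∈ A.domain, s • R z - A ⟨R z, hz⟩ = z}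

/-- The spectrum of `A`. -/
def spectrum (A : Z →ₗ.[ℂ] Z) : Set ℂ := (resolventSet A)ᶜ

/-- `l` is an eigenvalue of `A`. -/
def IsEigenvalue (A : Z →ₗ.[ℂ] Z) (l : ℂ) : Prop :=
  ∃ x : A.domain, (x : Z) ≠ 0 ∧ A x = l • (x : Z)

/-- `ker (l I - A) ^ n`, where `(l I - A) ^ n` has its natural domain. -/
def kerPow (A : Z →ₗ.[ℂ] Z) (l : ℂ) : ℕ → Submodule ℂ Z
  | 0 => ⊥
  | n + 1 => ((kerPow A l n).comap (l • A.domain.subtype - A.toFun)).map A.domain.subtype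

/-- The root subspace `⋃ n, ker (l I - A) ^ n`; its dimension is the algebraic multiplicity of the
eigenvalue `l`. -/
def rootSubspace (A : Z →ₗ.[ℂ] Z) (l : ℂ) : Submodule ℂ Z := ⨆ n, kerPow A l n

/-- The system `Σ(A,B,C,D)`, that is `x' = A x + B u`, `y = C x + D u`, with scalar input and
output, `B, C ≠ 0`, where `A` generates a `C₀`-semigroup and `σ(A)` is nonempty and consists of
isolated eigenvalues with finite algebraic multiplicity only. The feedthrough `D` is an arbitrary
scalar on which no condition is imposed, so it does not appear here. -/
structure IsSystem (A : Z →ₗ.[ℂ] Z) (B : ℂ →L[ℂ] Z) (C : Z →L[ℂ] ℂ) : Prop where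
  generator : ∃ T : C0Semigroup Z, T.IsGenerator A
  input_ne_zero : B ≠ 0
  output_ne_zero : C ≠ 0
  spectrum_nonempty : (spectrum A).Nonempty
  isolated : ∀ l ∈ spectrum A, ¬ AccPt l (𝓟 (spectrum A))
  eigenvalue : ∀ l ∈ spectrum A, IsEigenvalue A l
  finite_multiplicity : ∀ l ∈ spectrum A, FiniteDimensional ℂ (rootSubspace A l)

/-- The set of invariant zeros of `Σ(A,B,C,D)`. -/
def invariantZeros (A : Z →ₗ.[ℂ] Z) (B : ℂ →L[ℂ] Z) (C : Z →L[ℂ] ℂ) (D : ℂ) : Set ℂ :=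
  {l | ∃ (x : A.domain) (u : ℂ), (x : Z) ≠ 0 ∧
    l • (x : Z) - A x - B u = 0 ∧ C (x : Z) + D * u = 0}

/-- The system `Σ(A,B,C,D)` is minimal: no invariant zero belongs to the spectrum of `A`. -/
def IsMinimal (A : Z →ₗ.[ℂ] Z) (B : ℂ →L[ℂ] Z) (C : Z →L[ℂ] ℂ) (D : ℂ) : Prop :=
  invariantZeros A B C D ∩ spectrum A = ∅

/-- `A` is skew-adjoint: it is densely defined and `A* = -A`, domains included. -/
def IsSkewAdjoint [CompleteSpace Z] (A : Z →ₗ.[ℂ] Z) : Prop :=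
  Dense (A.domain : Set Z) ∧ A.adjoint = -A

/-- `Σ(A,B,C) = Σ(A,B,C,0)` is a collocated skew-adjoint system. -/
structure IsCollocatedSkewAdjoint [CompleteSpace Z] (A : Z →ₗ.[ℂ] Z) (B : ℂ →L[ℂ] Z)
    (C : Z →L[ℂ] ℂ) : Prop where
  system : IsSystem A B C
  skewAdjoint : IsSkewAdjoint A
  collocated : C = ContinuousLinearMap.adjoint B

/-- The closed-loop operator `A - k B C`, with domain `D(A)`. -/
noncomputable def closedLoop (A : Z →ₗ.[ℂ] Z) (B : ℂ →L[ℂ] Z) (C : Z →L[ℂ] ℂ) (k : ℝ) : Z →ₗ.[ℂ] Z where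
  domain := A.domain
  toFun := A.toFun - (k : ℂ) • ((B.comp C : Z →L[ℂ] Z) : Z →ₗ[ℂ] Z).comp A.domain.subtype

end

end RootLocus

namespace RootLocus

/-! ### Strongly continuous semigroups: local bounds, continuity of orbits, one-sided derivatives.
-/

section Semigroup

variable {Z : Type*} [NormedAddCommGroup Z] [InnerProductSpace ℂ Z]

/-! Put `b = B 1`, so that `BB*` is the rank-one map `x ↦ ⟨b, x⟩ b`. The semigroup `S` of `A` is
unitary. In the interaction picture `v(t) = S(t)* T(t) x` the closed loop becomes `v' = -k ⟨G, v⟩ G`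
with `G(t) = S(t)* b`, an equation with bounded coefficients and energy balance `(‖v‖²)' = -2k |⟨G,
v⟩|²`. Solving it yields a semigroup `S(t) v(t)` generated by `A - kBB*`. Conversely, for any
semigroup with this generator, orbits from `D(A)` have this form (`IsGenerator.isDampedFlow`), so
contractivity and stability are proved for all of them without a uniqueness theorem.

Stability is a LaSalle argument. Since the energy converges, `⟨G, v⟩ → 0` and `v(t + s) - v(t) → 0`;
thus `T(t)x` asymptotically moves along `S`. The vectors `g` with `⟨g, T(t)x⟩ → 0` therefore form a
closed subspace that contains `b` and reduces `S`. Minimality says that no eigenvector of `A` is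
orthogonal to `b`, which forces every eigenvector into this subspace. The spectral hypotheses make
the resolvent compact, so the eigenvectors span a dense subspace and `T(t)x → 0` weakly.

For `x ∈ D(A)` the vectors `A T(t)x` stay bounded, so compactness of the resolvent puts the orbit in
a compact set and weak convergence becomes norm convergence. Contractivity and density of `D(A)`
give all initial states. -/

theorem hasDerivWithinAt_Ici_iff_tendsto_nnreal {f : ℝ → Z} {t : ℝ} {y : Z} :
    HasDerivWithinAt f y (Set.Ici t) t ↔
      Tendsto (fun h : ℝ≥0 => ((h : ℝ) : ℂ)⁻¹ • (f (t + h) - f t)) (𝓝[>] 0) (𝓝 y) := by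
  rw [← hasDerivWithinAt_Ioi_iff_Ici, hasDerivWithinAt_iff_tendsto_slope' (by simp)]
  have h1 : Tendsto (fun h : ℝ≥0 => t + (h : ℝ)) (𝓝[>] 0) (𝓝[>] t) := by
    refine tendsto_nhdsWithin_iff.2 ⟨?_, ?_⟩
    · have : Continuous (fun h : ℝ≥0 => t + (h : ℝ)) := by fun_prop
      simpa using (this.tendsto 0).mono_left nhdsWithin_le_nhds
    · filter_upwards [self_mem_nhdsWithin] with h hh
      simpa using hh
  have h2 : Tendsto (fun r : ℝ => (r - t).toNNReal) (𝓝[>] t) (𝓝[>] 0) := by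
    refine tendsto_nhdsWithin_iff.2 ⟨?_, ?_⟩
    · have : Continuous (fun r : ℝ => (r - t).toNNReal) := by fun_prop
      simpa using (this.tendsto t).mono_left nhdsWithin_le_nhds
    · filter_upwards [self_mem_nhdsWithin] with r hr
      simpa using hr
  constructor
  · intro h
    refine (h.comp h1).congr fun r => ?_
    simp [slope, ← Complex.ofReal_inv]
  · intro h
    refine (h.comp h2).congr' ?_
    filter_upwards [self_mem_nhdsWithin] with r hr
    have hr' : 0 ≤ r - t := by simpa using (le_of_lt hr)
    simp [slope, ← Complex.ofReal_inv, hr', -Complex.ofReal_sub]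

namespace C0Semigroup

variable (T : C0Semigroup Z)

theorem map_add_apply (s t : ℝ≥0) (x : Z) : T.toFun (s + t) x = T.toFun s (T.toFun t x) := by
  rw [T.map_add]; rfl

/-- Otherwise `‖T(tₙ)‖ > n + 1` along some `tₙ → 0`, although each `T(tₙ)x` converges; this
contradicts Banach–Steinhaus. -/
theorem exists_norm_le_near_zero [CompleteSpace Z] :
    ∃ δ : ℝ≥0, 0 < δ ∧ ∃ M : ℝ, 1 ≤ M ∧ ∀ t ≤ δ, ‖T.toFun t‖ ≤ M := by
  by_contra! hcon
  have h1 : ∀ n : ℕ, ∃ t : ℝ≥0, t ≤ 1 / ((n : ℝ≥0) + 1) ∧ (n : ℝ) + 1 < ‖T.toFun t‖ := fun n =>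
    hcon (1 / ((n : ℝ≥0) + 1)) (by positivity) (n + 1) (by simp)
  choose t ht hn using h1
  have ht0 : Tendsto t atTop (𝓝 0) :=
    tendsto_of_tendsto_of_tendsto_of_le_of_le tendsto_const_nhds
      tendsto_one_div_add_atTop_nhds_zero_nat (fun _ => zero_le) ht
  obtain ⟨C, hC⟩ := banach_steinhaus (g := fun n => T.toFun (t n)) fun x => by
    obtain ⟨C, hC⟩ := (Metric.isBounded_range_of_tendsto _
      ((T.tendsto_zero x).comp ht0)).exists_norm_le
    exact ⟨C, fun n => hC _ ⟨n, rfl⟩⟩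
  obtain ⟨n, hnC⟩ := exists_nat_gt C
  linarith [hn n, hC n]

theorem exists_norm_le [CompleteSpace Z] (r : ℝ≥0) : ∃ M : ℝ, ∀ t ≤ r, ‖T.toFun t‖ ≤ M := by
  obtain ⟨δ, hδ, M, hM, h⟩ := T.exists_norm_le_near_zero
  have key : ∀ n : ℕ, ∀ t ≤ n * δ, ‖T.toFun t‖ ≤ M ^ n := by
    intro n
    induction n with
    | zero =>
      intro t ht
      have : t = 0 := by simpa using ht
      simpa [this, T.map_zero] using ContinuousLinearMap.norm_id_le
    | succ n ih =>
      intro t ht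
      rcases le_total t δ with htδ | htδ
      · exact (h t htδ).trans (le_self_pow₀ hM (by simp))
      · have h1 : t - δ ≤ n * δ := by
          rw [tsub_le_iff_right]; push_cast at ht; linarith
        have h2 : t = δ + (t - δ) := (add_tsub_cancel_of_le htδ).symm
        rw [h2, T.map_add, pow_succ']
        exact (ContinuousLinearMap.opNorm_comp_le _ _).trans
          (mul_le_mul (h δ le_rfl) (ih _ h1) (norm_nonneg _) (by linarith))
  obtain ⟨n, hn⟩ := exists_nat_ge (r / δ)
  exact ⟨M ^ n, fun t ht => key n t (ht.trans ((div_le_iff₀ hδ).1 hn))⟩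

theorem continuous_apply [CompleteSpace Z] (x : Z) : Continuous fun t => T.toFun t x := by
  rw [continuous_iff_continuousAt]
  intro t
  obtain ⟨M, hM⟩ := T.exists_norm_le (t + 1)
  have h0 := T.tendsto_zero x
  -- Subtraction on `ℝ≥0` is truncated, so this sum is `|r - t|`.
  have hd : Tendsto (fun r : ℝ≥0 => (r - t) + (t - r)) (𝓝 t) (𝓝 0) := by
    have : Continuous (fun r : ℝ≥0 => (r - t) + (t - r)) := by fun_prop
    simpa using this.tendsto t
  have h1 : Tendsto (fun r : ℝ≥0 => M * ‖T.toFun ((r - t) + (t - r)) x - x‖) (𝓝 t) (𝓝 0) := by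
    have := (((h0.comp hd).sub_const x).norm).const_mul M
    simpa using this
  refine tendsto_iff_norm_sub_tendsto_zero.2 (squeeze_zero' (.of_forall fun _ => norm_nonneg _) ?_ h1)
  filter_upwards [eventually_le_nhds (show t < t + 1 by simp)] with r hr
  rcases le_total r t with h | h
  · have h2 : t = r + (t - r) := (add_tsub_cancel_of_le h).symm
    rw [tsub_eq_zero_of_le h, zero_add, norm_sub_rev]
    calc ‖T.toFun t x - T.toFun r x‖ = ‖T.toFun r (T.toFun (t - r) x - x)‖ := by
          rw [map_sub, ← T.map_add_apply, ← h2]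
      _ ≤ _ := (T.toFun r).le_of_opNorm_le (hM r hr) _
  · have h2 : r = t + (r - t) := (add_tsub_cancel_of_le h).symm
    rw [tsub_eq_zero_of_le h, add_zero]
    calc ‖T.toFun r x - T.toFun t x‖ = ‖T.toFun t (T.toFun (r - t) x - x)‖ := by
          rw [map_sub, ← T.map_add_apply, ← h2]
      _ ≤ _ := (T.toFun t).le_of_opNorm_le (hM t (by simp)) _

theorem continuous_toNNReal_apply [CompleteSpace Z] (x : Z) :
    Continuous fun t : ℝ => T.toFun t.toNNReal x :=
  (T.continuous_apply x).comp continuous_real_toNNReal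

variable {T} {A : Z →ₗ.[ℂ] Z}

theorem IsGenerator.tendsto (hT : T.IsGenerator A) (x : A.domain) :
    Tendsto (fun h : ℝ≥0 => ((h : ℝ) : ℂ)⁻¹ • (T.toFun h x - x)) (𝓝[>] 0) (𝓝 (A x)) :=
  (hT x (A x)).1 ⟨x.2, rfl⟩

theorem IsGenerator.exists_apply_eq (hT : T.IsGenerator A) (t : ℝ≥0) (x : A.domain) :
    ∃ h : T.toFun t x ∈ A.domain, A ⟨T.toFun t x, h⟩ = T.toFun t (A x) := by
  rw [hT]
  refine (((T.toFun t).continuous.tendsto _).comp (hT.tendsto x)).congr fun h => ?_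
  simp only [Function.comp_apply, map_smul, map_sub, ← T.map_add_apply, add_comm]

theorem IsGenerator.hasDerivWithinAt (hT : T.IsGenerator A) (x : A.domain) {t : ℝ} (ht : 0 ≤ t) :
    HasDerivWithinAt (fun r : ℝ => T.toFun r.toNNReal x) (T.toFun t.toNNReal (A x))
      (Set.Ici t) t := by
  rw [hasDerivWithinAt_Ici_iff_tendsto_nnreal]
  refine (((T.toFun t.toNNReal).continuous.tendsto _).comp (hT.tendsto x)).congr fun h => ?_
  simp [Real.toNNReal_add ht, T.map_add_apply]

end C0Semigroup

end Semigroup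

/-! ### Isometry of the semigroup and its action on eigenvectors. -/

section SkewAdjoint

variable {Z : Type*} [NormedAddCommGroup Z] [InnerProductSpace ℂ Z] [CompleteSpace Z]
  {A : Z →ₗ.[ℂ] Z}

theorem IsSkewAdjoint.inner_apply_left (hA : IsSkewAdjoint A) (x y : A.domain) :
    inner ℂ (A x) (y : Z) = -inner ℂ (x : Z) (A y) := by
  have h := LinearPMap.adjoint_isFormalAdjoint hA.1
  rw [hA.2] at h
  rw [← neg_eq_iff_eq_neg, ← inner_neg_left]
  exact h x y

theorem IsSkewAdjoint.star_eigenvalue (hA : IsSkewAdjoint A) {l : ℂ} (hl : IsEigenvalue A l) :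
    (starRingEnd ℂ) l = -l := by
  obtain ⟨x, hx, hxl⟩ := hl
  have h := hA.inner_apply_left x x
  rw [hxl, inner_smul_left, inner_smul_right, ← neg_mul] at h
  exact mul_right_cancel₀ (inner_self_ne_zero.2 hx) h

theorem IsSkewAdjoint.norm_semigroup_apply (hA : IsSkewAdjoint A) {S : C0Semigroup Z}
    (hS : S.IsGenerator A) (t : ℝ≥0) (x : Z) : ‖S.toFun t x‖ = ‖x‖ := by
  have key : ∀ x : A.domain, ‖S.toFun t x‖ = ‖(x : Z)‖ := by
    intro x
    have h := constant_of_has_deriv_right_zero (a := 0) (b := (t : ℝ))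
      (f := fun r : ℝ => inner ℂ (S.toFun r.toNNReal (x : Z)) (S.toFun r.toNNReal (x : Z)))
      (Continuous.inner (S.continuous_toNNReal_apply _)
        (S.continuous_toNNReal_apply _)).continuousOn
      (fun r hr => by
        have h1 := (hS.hasDerivWithinAt x hr.1).inner ℂ (hS.hasDerivWithinAt x hr.1)
        convert! h1 using 1
        obtain ⟨hm, hAm⟩ := hS.exists_apply_eq r.toNNReal x
        have h2 := hA.inner_apply_left ⟨_, hm⟩ ⟨_, hm⟩
        rw [hAm] at h2
        simp [h2]) t ⟨t.2, le_rfl⟩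
    simp only [Real.toNNReal_coe, Real.toNNReal_zero, S.map_zero, inner_self_eq_norm_sq_to_K] at h
    have h3 : ‖S.toFun t (x : Z)‖ ^ 2 = ‖(x : Z)‖ ^ 2 := by exact_mod_cast h
    exact (pow_left_inj₀ (norm_nonneg _) (norm_nonneg _) two_ne_zero).1 h3
  have hcl : IsClosed {x : Z | ‖S.toFun t x‖ = ‖x‖} :=
    isClosed_eq (by fun_prop) (by fun_prop)
  exact (hA.1.closure_eq ▸ hcl.closure_subset_iff.2 fun y hy => key ⟨y, hy⟩) (Set.mem_univ x)

theorem C0Semigroup.IsGenerator.apply_eigenvector {S : C0Semigroup Z} (hS : S.IsGenerator A)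
    {x : A.domain} {l : ℂ} (hx : A x = l • (x : Z)) (t : ℝ≥0) :
    S.toFun t x = Complex.exp (l * (t : ℝ)) • (x : Z) := by
  have hc : ∀ r : ℝ, HasDerivAt (fun r : ℝ => Complex.exp (-l * r))
      (Complex.exp (-l * r) * (-l)) r := by
    intro r
    have : HasDerivAt (fun r : ℝ => -l * (r : ℂ)) (-l) r := by
      simpa using (Complex.ofRealCLM.hasDerivAt (x := r)).const_mul (-l)
    exact this.cexp
  have h := constant_of_has_deriv_right_zero (a := 0) (b := (t : ℝ))
    (f := fun r : ℝ => Complex.exp (-l * r) • S.toFun r.toNNReal (x : Z))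
    (Continuous.smul (by fun_prop) (S.continuous_toNNReal_apply _)).continuousOn
    (fun r hr => by
      have h1 := (hc r).hasDerivWithinAt.smul (hS.hasDerivWithinAt x hr.1)
      convert! h1 using 1
      rw [hx, map_smul]
      module) t ⟨t.2, le_rfl⟩
  simp only [Real.toNNReal_coe, Real.toNNReal_zero, S.map_zero, Complex.ofReal_zero, mul_zero,
    Complex.exp_zero, one_smul, ContinuousLinearMap.id_apply] at h
  conv_rhs => rw [← h, smul_smul, ← Complex.exp_add]
  simp

omit [CompleteSpace Z] in
/-- A common eigenvector of the semigroup is an eigenvector of the generator. -/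
theorem C0Semigroup.IsGenerator.apply_eq_of_semigroup_eigenvector {S : C0Semigroup Z}
    (hS : S.IsGenerator A) {x : Z} {l : ℂ}
    (hx : ∀ t : ℝ≥0, S.toFun t x = Complex.exp (l * (t : ℝ)) • x) :
    ∃ h : x ∈ A.domain, A ⟨x, h⟩ = l • x := by
  rw [hS]
  have h1 : HasDerivAt (fun r : ℝ => Complex.exp (l * r) • x) (l • x) 0 := by
    have : HasDerivAt (fun r : ℝ => l * (r : ℂ)) l 0 := by
      simpa using (Complex.ofRealCLM.hasDerivAt (x := (0 : ℝ))).const_mul l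
    simpa using (this.cexp).smul_const x
  have h2 := hasDerivWithinAt_Ici_iff_tendsto_nnreal.1 (h1.hasDerivWithinAt (s := Set.Ici 0))
  refine h2.congr fun h => ?_
  simp [hx]

end SkewAdjoint

/-! ### Compactness of self-adjoint operators read off from the spectrum. -/

section Compactness

variable {Z : Type*} [NormedAddCommGroup Z] [InnerProductSpace ℂ Z] [CompleteSpace Z]

/-- A spectral component at an isolated point of the spectrum with finite-dimensional eigenspace is
a compact operator. -/
theorem isCompactOperator_cfc_ite {H : Z →L[ℂ] Z} (hH : IsSelfAdjoint H) {m : ℝ}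
    (hiso : ¬ AccPt m (𝓟 (_root_.spectrum ℝ H)))
    (hfin : FiniteDimensional ℂ (Module.End.eigenspace (H : Z →ₗ[ℂ] Z) (m : ℂ))) :
    ContinuousOn (fun x : ℝ => if x = m then m else 0) (_root_.spectrum ℝ H) ∧
      IsCompactOperator (cfc (fun x : ℝ => if x = m then m else 0) H : Z →L[ℂ] Z) := by
  have hc : ContinuousOn (fun x : ℝ => if x = m then m else 0) (_root_.spectrum ℝ H) := by
    intro x hx
    by_cases hxm : x = m
    · subst hxm
      rw [accPt_iff_frequently, not_frequently] at hiso
      refine (continuousWithinAt_const (b := x)).congr_of_eventuallyEq ?_ (by simp)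
      filter_upwards [nhdsWithin_le_nhds hiso, self_mem_nhdsWithin] with y hy hys
      have : y = x := by tauto
      simp [this]
    · refine (continuousWithinAt_const (b := (0 : ℝ))).congr_of_eventuallyEq ?_ (by simp [hxm])
      filter_upwards [nhdsWithin_le_nhds (isOpen_ne.mem_nhds hxm)] with y hy
      simp [hy]
  refine ⟨hc, ?_⟩
  set P := cfc (fun x : ℝ => if x = m then m else 0) H with hP
  -- On the spectrum `x · f(x) = m · f(x)`, so the range of `P` lies in the finite-dimensional
  -- eigenspace.
  have hHP : H * P = m • P := by
    have h1 : cfc (fun x : ℝ => x * (if x = m then m else 0)) H = H * P := by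
      rw [cfc_mul (fun x : ℝ => x) _ H (by fun_prop) hc, cfc_id' ℝ H]
    rw [← h1, hP, ← cfc_smul m _ H hc]
    congr 1
    ext x
    by_cases hx : x = m <;> simp [hx]
  have hmem : ∀ z, P z ∈ Module.End.eigenspace (H : Z →ₗ[ℂ] Z) (m : ℂ) := by
    intro z
    rw [Module.End.mem_eigenspace_iff]
    have := congrArg (fun Q : Z →L[ℂ] Z => Q z) hHP
    simpa using this
  have : IsCompactOperator (P.codRestrict _ hmem) := isCompactOperator_of_locallyCompactSpace_dom _
  exact this.clm_comp (Submodule.subtypeL _)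

/-- A self-adjoint operator whose nonzero spectrum consists of isolated points with
finite-dimensional eigenspaces is compact. -/
theorem isCompactOperator_of_isolated_spectrum {H : Z →L[ℂ] Z} (hH : IsSelfAdjoint H)
    (hiso : ∀ m ∈ _root_.spectrum ℝ H, m ≠ 0 → ¬ AccPt m (𝓟 (_root_.spectrum ℝ H)))
    (hfin : ∀ m ∈ _root_.spectrum ℝ H, m ≠ 0 →
      FiniteDimensional ℂ (Module.End.eigenspace (H : Z →ₗ[ℂ] Z) (m : ℂ))) :
    IsCompactOperator H := by
  refine isClosed_setOfPred_isCompactOperator.closure_subset (Metric.mem_closure_iff.2 ?_)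
  intro ε hε
  -- Truncation: only finitely many spectral points have modulus at least `ε / 2`, and dropping the
  -- others changes `H` by at most `ε / 2` in norm.
  set K : Set ℝ := _root_.spectrum ℝ H ∩ {x | ε / 2 ≤ |x|} with hK
  have hKc : IsCompact K :=
    (spectrum.isCompact H).inter_right (isClosed_le continuous_const continuous_abs)
  have hne : ∀ m ∈ K, m ≠ 0 := by
    rintro m ⟨-, hm⟩ rfl
    simp only [Set.mem_ofPred_eq, abs_zero] at hm
    linarith
  have hKf : K.Finite := by
    by_contra hinf
    obtain ⟨x, hx, hacc⟩ := Set.Infinite.exists_accPt_of_subset_isCompact hinf hKc subset_rfl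
    exact hiso x hx.1 (hne x hx) (hacc.mono (principal_mono.2 Set.inter_subset_left))
  have hcomp := fun m (hm : m ∈ hKf.toFinset) =>
    isCompactOperator_cfc_ite hH (hiso m (hKf.mem_toFinset.1 hm).1 (hne m (hKf.mem_toFinset.1 hm)))
      (hfin m (hKf.mem_toFinset.1 hm).1 (hne m (hKf.mem_toFinset.1 hm)))
  refine ⟨∑ m ∈ hKf.toFinset, cfc (fun x : ℝ => if x = m then m else 0) H,
    Submodule.sum_mem (compactOperator (RingHom.id ℂ) Z Z) fun m hm => (hcomp m hm).2, ?_⟩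
  have hcs : ContinuousOn (∑ m ∈ hKf.toFinset, fun x : ℝ => if x = m then m else 0)
      (_root_.spectrum ℝ H) := by
    rw [Finset.sum_fn]
    exact continuousOn_finsetSum _ fun m hm => (hcomp m hm).1
  rw [dist_eq_norm, ← cfc_sum _ _ _ fun m hm => (hcomp m hm).1]
  nth_rw 1 [← cfc_id' ℝ H]
  rw [← cfc_sub _ _ H (by fun_prop) hcs]
  refine (norm_cfc_le (half_pos hε).le fun x hx => ?_).trans_lt (half_lt_self hε)
  by_cases hxK : x ∈ K
  · simpa [Finset.sum_apply, hxK] using (half_pos hε).le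
  · have : |x| < ε / 2 := by
      by_contra! h
      exact hxK ⟨hx, h⟩
    simpa [Finset.sum_apply, hxK] using this.le

/-- A closed subspace containing the eigenvectors of an injective compact self-adjoint operator is
the whole space. -/
theorem eq_top_of_eigenvectors_mem {H : Z →L[ℂ] Z} (hH : IsSelfAdjoint H)
    (hc : IsCompactOperator H) (N : Submodule ℂ Z) (hN : IsClosed (N : Set Z))
    (h : ∀ (x : Z) (m : ℂ), x ≠ 0 → H x = m • x → x ∈ N) : N = ⊤ := by
  have hle : (⨆ m, Module.End.eigenspace (H : Z →ₗ[ℂ] Z) m) ≤ N := by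
    refine iSup_le fun m x hx => ?_
    rw [Module.End.mem_eigenspace_iff] at hx
    by_cases h0 : x = 0
    · simp [h0]
    · exact h x m h0 hx
  have h1 := ContinuousLinearMap.orthogonalComplement_iSup_eigenspaces_eq_bot hc
    hH.isSymmetric
  have : CompleteSpace N := hN.completeSpace_coe
  rw [← Submodule.orthogonal_eq_bot_iff, eq_bot_iff]
  exact (Submodule.orthogonal_le hle).trans h1.le

end Compactness

/-! ### Compact resolvent and completeness of the eigenvectors of `A`. -/

section Resolvent

variable {Z : Type*} [NormedAddCommGroup Z] [InnerProductSpace ℂ Z] {A : Z →ₗ.[ℂ] Z}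

/-- `R` is the resolvent `(s I - A)⁻¹`. -/
structure IsResolvent (A : Z →ₗ.[ℂ] Z) (s : ℂ) (R : Z →L[ℂ] Z) : Prop where
  left_inv : ∀ x : A.domain, R (s • (x : Z) - A x) = x
  right_inv : ∀ z : Z, ∃ hz : R z ∈ A.domain, s • R z - A ⟨R z, hz⟩ = z

theorem IsResolvent.sub_apply {s l : ℂ} {R Q : Z →L[ℂ] Z} (hR : IsResolvent A s R)
    (hQ : IsResolvent A l Q) (z : Z) : R z - Q z = (l - s) • R (Q z) := by
  obtain ⟨hz, h⟩ := hQ.right_inv z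
  have h1 : z = (s • Q z - A ⟨Q z, hz⟩) + (l - s) • Q z := by
    conv_lhs => rw [← h]
    module
  conv_lhs => rw [h1]
  rw [map_add, hR.left_inv ⟨Q z, hz⟩, ← h1, map_smul]
  simp

theorem IsResolvent.apply_eq_of_eigenvector {s : ℂ} {R : Z →L[ℂ] Z} (hR : IsResolvent A s R) {m : ℝ}
    (hm : m ≠ 0) {x : Z} (hx : (Complex.I • R) x = (m : ℂ) • x) :
    ∃ h : x ∈ A.domain, A ⟨x, h⟩ = (s - Complex.I / m) • x := by
  have hm' : (m : ℂ) ≠ 0 := by exact_mod_cast hm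
  obtain ⟨hz, h⟩ := hR.right_inv x
  have hx' : x = (Complex.I / m) • R x := by
    rw [div_eq_inv_mul, mul_smul, ← smul_apply, hx, smul_smul,
      inv_mul_cancel₀ hm', one_smul]
  have hxd : x ∈ A.domain := by
    rw [hx']; exact A.domain.smul_mem _ hz
  refine ⟨hxd, ?_⟩
  have h2 : (⟨x, hxd⟩ : A.domain) = (Complex.I / m) • ⟨R x, hz⟩ := Subtype.ext hx'
  have h3 : A ⟨R x, hz⟩ = s • R x - x := by
    rw [eq_sub_iff_add_eq', ← eq_sub_iff_add_eq, h]
  rw [h2, LinearPMap.map_smul, h3, smul_sub, smul_comm, ← hx', sub_smul]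

/-- With `l = s - i/m` one has `m - iR = m (l - A) R`, so a resolvent `Q` at `l` would give the
inverse `m⁻¹ (s - A) Q = m⁻¹ (1 + (i/m) Q)`. -/
theorem IsResolvent.sub_mem_spectrum {s : ℂ} {R : Z →L[ℂ] Z} (hR : IsResolvent A s R) {m : ℝ}
    (hm : m ≠ 0) (hmem : m ∈ _root_.spectrum ℝ (Complex.I • R)) :
    s - Complex.I / m ∈ RootLocus.spectrum A := by
  have hm' : (m : ℂ) ≠ 0 := by exact_mod_cast hm
  rintro ⟨Q, hQ1, hQ2⟩
  have hQ : IsResolvent A (s - Complex.I / m) Q := ⟨hQ1, hQ2⟩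
  refine hmem ?_
  have hRQ : ∀ z, R (Q z) = (m * Complex.I : ℂ) • (R z - Q z) := by
    intro z
    rw [hR.sub_apply hQ, smul_smul]
    have : (m * Complex.I : ℂ) * (s - Complex.I / m - s) = 1 := by
      field_simp
      ring_nf
      simp
    rw [this, one_smul]
  have hQR : ∀ z, Q (R z) = (m * Complex.I : ℂ) • (R z - Q z) := by
    intro z
    rw [← neg_sub, hQ.sub_apply hR, smul_neg, smul_smul, ← neg_smul]
    have : -((m * Complex.I : ℂ) * (s - (s - Complex.I / m))) = 1 := by
      field_simp
      ring_nf
      simp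
    rw [this, one_smul]
  have hI : (m : ℂ)⁻¹ * m = 1 := inv_mul_cancel₀ hm'
  refine isUnit_iff_exists.2 ⟨(m : ℂ)⁻¹ • (1 + (Complex.I / m) • Q), ?_, ?_⟩
  · ext z
    simp only [mul_apply_eq_comp, smul_apply,
      _root_.sub_apply, Algebra.algebraMap_eq_smul_one, _root_.add_apply,
      one_apply_eq_self, map_add, map_smul, hRQ, ← Complex.coe_smul]
    match_scalars <;> field_simp <;> ring_nf <;> simp
  · ext z
    simp only [mul_apply_eq_comp, smul_apply,
      _root_.sub_apply, Algebra.algebraMap_eq_smul_one, _root_.add_apply,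
      one_apply_eq_self, map_sub, map_smul, hQR, ← Complex.coe_smul]
    match_scalars <;> field_simp <;> ring_nf <;> simp

theorem mem_rootSubspace {x : A.domain} {l : ℂ} (hx : A x = l • (x : Z)) :
    (x : Z) ∈ rootSubspace A l := by
  refine le_iSup (kerPow A l) 1 ⟨x, ?_, rfl⟩
  have : l • (x : Z) - A x = 0 := by rw [hx, sub_self]
  simpa [kerPow] using this

variable [CompleteSpace Z]

theorem IsSkewAdjoint.isSelfAdjoint_smul_resolvent (hA : IsSkewAdjoint A) {s : ℂ}
    (hs : (starRingEnd ℂ) s = -s) {R : Z →L[ℂ] Z} (hR : IsResolvent A s R) :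
    IsSelfAdjoint (Complex.I • R) := by
  rw [ContinuousLinearMap.isSelfAdjoint_iff_isSymmetric]
  intro u w
  obtain ⟨hu, hu'⟩ := hR.right_inv u
  obtain ⟨hw, hw'⟩ := hR.right_inv w
  have h := hA.inner_apply_left ⟨R u, hu⟩ ⟨R w, hw⟩
  have h1 : inner ℂ (R u) w = -inner ℂ u (R w) := by
    conv_lhs => rw [← hw']
    conv_rhs => rw [← hu']
    simp only [inner_sub_left, inner_sub_right, inner_smul_left, inner_smul_right, hs] at h ⊢
    rw [h]
    ring
  simp [inner_smul_left, inner_smul_right, h1]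

/-- An eigenvalue of a skew-adjoint operator is imaginary, and being isolated in the spectrum it has
resolvent points just above it on the imaginary axis. -/
theorem IsSystem.exists_imaginary_resolvent {B : ℂ →L[ℂ] Z} {C : Z →L[ℂ] ℂ} (h : IsSystem A B C)
    (hA : IsSkewAdjoint A) :
    ∃ (s : ℂ) (R : Z →L[ℂ] Z), (starRingEnd ℂ) s = -s ∧ IsResolvent A s R := by
  obtain ⟨l, hl⟩ := h.spectrum_nonempty
  have hiso := h.isolated l hl
  rw [accPt_iff_frequently, not_frequently] at hiso
  have hc : Continuous fun r : ℝ => l + r * Complex.I := by fun_prop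
  have ht : Tendsto (fun r : ℝ => l + r * Complex.I) (𝓝[>] 0) (𝓝 l) := by
    simpa using (hc.tendsto 0).mono_left nhdsWithin_le_nhds
  obtain ⟨r, hr, hr0⟩ := ((ht.eventually hiso).and self_mem_nhdsWithin).exists
  have hr0 : (0 : ℝ) < r := hr0
  have hmem : l + r * Complex.I ∈ resolventSet A := by
    by_contra hcon
    exact hr ⟨by simpa using hr0.ne', hcon⟩
  obtain ⟨R, h1, h2⟩ := hmem
  refine ⟨_, R, ?_, ⟨h1, h2⟩⟩
  rw [map_add, hA.star_eigenvalue (h.eigenvalue l hl)]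
  simp
  ring

/-- Away from `0`, the map `m ↦ s - i/m` carries the spectrum of `iR` continuously and injectively
into `σ(A)`, and eigenspaces into root subspaces; isolation and finite multiplicity are thus
inherited. -/
theorem IsSystem.isCompactOperator_resolvent {B : ℂ →L[ℂ] Z} {C : Z →L[ℂ] ℂ}
    (h : IsSystem A B C) (hA : IsSkewAdjoint A) {s : ℂ} {R : Z →L[ℂ] Z}
    (hs : (starRingEnd ℂ) s = -s) (hR : IsResolvent A s R) :
    IsCompactOperator (Complex.I • R) := by
  refine isCompactOperator_of_isolated_spectrum (hA.isSelfAdjoint_smul_resolvent hs hR) ?_ ?_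
  · intro m hm hm0 hacc
    refine h.isolated _ (hR.sub_mem_spectrum hm0 hm) ?_
    rw [accPt_iff_frequently] at hacc ⊢
    have hm' : (m : ℂ) ≠ 0 := by exact_mod_cast hm0
    have hcont : Tendsto (fun r : ℝ => s - Complex.I / r) (𝓝 m) (𝓝 (s - Complex.I / m)) :=
      tendsto_const_nhds.sub (tendsto_const_nhds.div (Complex.continuous_ofReal.tendsto m) hm')
    refine hcont.frequently ((hacc.and_eventually (isOpen_ne.mem_nhds hm0)).mono ?_)
    rintro r ⟨⟨hrm, hr⟩, hr0 : r ≠ 0⟩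
    refine ⟨fun heq => hrm ?_, hR.sub_mem_spectrum hr0 hr⟩
    have hr' : (r : ℂ) ≠ 0 := by exact_mod_cast hr0
    rw [sub_right_inj, div_eq_div_iff hr' hm'] at heq
    exact_mod_cast (mul_left_cancel₀ Complex.I_ne_zero heq).symm
  · intro m hm hm0
    have := h.finite_multiplicity _ (hR.sub_mem_spectrum hm0 hm)
    refine Submodule.finiteDimensional_of_le (S₂ := rootSubspace A (s - Complex.I / m)) ?_
    intro x hx
    rw [Module.End.mem_eigenspace_iff] at hx
    obtain ⟨hxd, hAx⟩ := hR.apply_eq_of_eigenvector hm0 (x := x) (by simpa using hx)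
    exact mem_rootSubspace hAx

theorem IsSystem.eq_top_of_eigenvectors_mem {B : ℂ →L[ℂ] Z} {C : Z →L[ℂ] ℂ}
    (h : IsSystem A B C) (hA : IsSkewAdjoint A) (N : Submodule ℂ Z) (hN : IsClosed (N : Set Z))
    (hmem : ∀ (x : A.domain) (l : ℂ), A x = l • (x : Z) → (x : Z) ∈ N) : N = ⊤ := by
  obtain ⟨s, R, hs, hR⟩ := h.exists_imaginary_resolvent hA
  have hsa := hA.isSelfAdjoint_smul_resolvent hs hR
  refine RootLocus.eq_top_of_eigenvectors_mem hsa (h.isCompactOperator_resolvent hA hs hR) N hN ?_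
  intro x m hx hxm
  have hreal : (starRingEnd ℂ) m = m := by
    have h1 := hsa.isSymmetric x x
    simp only [ContinuousLinearMap.coe_coe, hxm, inner_smul_left, inner_smul_right] at h1
    exact mul_right_cancel₀ (inner_self_ne_zero.2 hx) h1
  obtain ⟨r, rfl⟩ := Complex.conj_eq_iff_real.1 hreal
  have hr0 : r ≠ 0 := by
    rintro rfl
    have h2 : R x = 0 := by simpa using hxm
    obtain ⟨hz, hz'⟩ := hR.right_inv x
    have h3 : (⟨R x, hz⟩ : A.domain) = 0 := Subtype.ext h2
    rw [h3, h2, LinearPMap.map_zero] at hz'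
    exact hx (by simpa using hz'.symm)
  obtain ⟨hxd, hAx⟩ := hR.apply_eq_of_eigenvector hr0 hxm
  exact hmem ⟨x, hxd⟩ _ hAx

end Resolvent

/-! ### Linear non-autonomous equations via the Dyson series. -/

section LinearODE

variable {E : Type*} [NormedAddCommGroup E] [NormedSpace ℂ E]

/-- The terms of the Dyson series of the linear equation `v' t = f t (v t)`, `v 0 = x`. -/
noncomputable def dysonTerm (f : ℝ → E →L[ℂ] E) (x : E) : ℕ → ℝ → E
  | 0 => fun _ => x
  | n + 1 => fun t => ∫ s in (0 : ℝ)..t, f s (dysonTerm f x n s)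

variable {f : ℝ → E →L[ℂ] E} {x : E}

theorem hasDerivAt_dysonTerm_succ [CompleteSpace E]
    (hf : Continuous fun p : ℝ × E => f p.1 p.2) {n : ℕ}
    (hn : Continuous (dysonTerm f x n)) (t : ℝ) :
    HasDerivAt (dysonTerm f x (n + 1)) (f t (dysonTerm f x n t)) t :=
  ((hf.comp (continuous_id.prodMk hn)).integral_hasStrictDerivAt 0 t).hasDerivAt

theorem continuous_dysonTerm [CompleteSpace E]
    (hf : Continuous fun p : ℝ × E => f p.1 p.2) (n : ℕ) :
    Continuous (dysonTerm f x n) := by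
  induction n with
  | zero => exact continuous_const
  | succ n ih =>
    exact continuous_iff_continuousAt.2 fun t => (hasDerivAt_dysonTerm_succ hf ih t).continuousAt

theorem norm_dysonTerm_le [CompleteSpace E]
    (hf : Continuous fun p : ℝ × E => f p.1 p.2) {C : ℝ} (hC : ∀ t, ‖f t‖ ≤ C) (n : ℕ) (t : ℝ) :
    ‖dysonTerm f x n t‖ ≤ (C * |t|) ^ n / n.factorial * ‖x‖ := by
  have hC0 : 0 ≤ C := (norm_nonneg _).trans (hC 0)
  induction n generalizing t with
  | zero => simp [dysonTerm]
  | succ n ih =>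
    have h1 : Continuous fun s => f s (dysonTerm f x n s) :=
      hf.comp (continuous_id.prodMk (continuous_dysonTerm hf n))
    calc ‖dysonTerm f x (n + 1) t‖
        ≤ ∫ s in Set.uIoc 0 t, ‖f s (dysonTerm f x n s)‖ :=
          intervalIntegral.norm_integral_le_integral_norm_uIoc
      _ ≤ ∫ s in Set.uIoc 0 t, C ^ (n + 1) / n.factorial * ‖x‖ * |s - 0| ^ n := by
          refine MeasureTheory.integral_mono (h1.norm.integrableOn_uIoc)
            (Continuous.integrableOn_uIoc (by fun_prop)) fun s => ?_
          refine ((f s).le_of_opNorm_le (hC s) _).trans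
            ((mul_le_mul_of_nonneg_left (ih s) hC0).trans_eq ?_)
          simp only [sub_zero]
          ring
      _ = _ := by
          rw [MeasureTheory.integral_const_mul, integral_pow_abs_sub_uIoc, sub_zero,
            Nat.factorial_succ]
          push_cast
          field_simp
          ring

/-- Global solvability of linear non-autonomous equations with bounded coefficients. -/
theorem exists_forall_hasDerivAt_linear [CompleteSpace E]
    (hf : Continuous fun p : ℝ × E => f p.1 p.2) {C : ℝ} (hC : ∀ t, ‖f t‖ ≤ C) (x : E) :
    ∃ v : ℝ → E, v 0 = x ∧ ∀ t, HasDerivAt v (f t (v t)) t := by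
  have hC0 : 0 ≤ C := (norm_nonneg _).trans (hC 0)
  have hsum : ∀ t, Summable fun n => dysonTerm f x n t := fun t =>
    Summable.of_norm_bounded ((Real.summable_pow_div_factorial (C * |t|)).mul_right ‖x‖)
      fun n => norm_dysonTerm_le hf hC n t
  refine ⟨fun t => ∑' n, dysonTerm f x n t, ?_, fun t => ?_⟩
  · simp only
    rw [(hsum 0).tsum_eq_zero_add]
    simp [dysonTerm]
  · set r := |t| + 1 with hr
    -- The zeroth Dyson term is constant, so the sequence of derivatives is the image of the series
    -- under `f s`, shifted by one with `0` in front; `u` dominates it on the ball of radius `r`.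
    let g : ℕ → ℝ → E := fun n s => Nat.casesOn n 0 fun n => f s (dysonTerm f x n s)
    let u : ℕ → ℝ := fun n => Nat.casesOn n 0 fun n => C * ((C * r) ^ n / n.factorial * ‖x‖)
    have hu : Summable u := by
      rw [← summable_nat_add_iff 1]
      exact ((Real.summable_pow_div_factorial (C * r)).mul_right ‖x‖).mul_left C
    have h := hasDerivAt_tsum_of_isPreconnected (g := dysonTerm f x) (g' := g) (y₀ := 0) (y := t)
      hu Metric.isOpen_ball (convex_ball (0 : ℝ) r).isPreconnected ?_ ?_ ?_ (hsum 0) ?_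
    · convert! h using 1
      have hs : Summable fun n => g n t := by
        rw [← summable_nat_add_iff 1]
        exact (hsum t).map (f t) (f t).continuous
      rw [hs.tsum_eq_zero_add, (f t).map_tsum (hsum t)]
      simp [g]
    · rintro (_ | n) s -
      · exact hasDerivAt_const s x
      · exact hasDerivAt_dysonTerm_succ hf (continuous_dysonTerm hf n) s
    · rintro (_ | n) s hs
      · simp [g, u]
      · refine ((f s).le_of_opNorm_le (hC s) _).trans (mul_le_mul_of_nonneg_left ?_ hC0)
        refine (norm_dysonTerm_le hf hC n s).trans ?_
        have : |s| ≤ r := by simpa using (mem_ball_zero_iff.1 hs).le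
        gcongr
    · simp [hr]; positivity
    · simp [hr]

end LinearODE

/-! ### Energy estimates for the damped equation. -/

section DampedFlow

variable {Z : Type*} [NormedAddCommGroup Z] [InnerProductSpace ℂ Z]

/-- `v` solves `v' = -k ⟨G, v⟩ G` on `[0, ∞)`. -/
structure IsDampedFlow (G : ℝ → Z) (k : ℝ) (v : ℝ → Z) : Prop where
  continuousOn : ContinuousOn v (Set.Ici 0)
  hasDerivWithinAt : ∀ t, 0 ≤ t →
    HasDerivWithinAt v (-((k : ℂ) • inner ℂ (G t) (v t) • G t)) (Set.Ici t) t

namespace IsDampedFlow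

variable {G : ℝ → Z} {k : ℝ} {v w : ℝ → Z}

theorem add (hv : IsDampedFlow G k v) (hw : IsDampedFlow G k w) :
    IsDampedFlow G k fun t => v t + w t where
  continuousOn := hv.continuousOn.add hw.continuousOn
  hasDerivWithinAt t ht := by
    convert! (hv.hasDerivWithinAt t ht).add (hw.hasDerivWithinAt t ht) using 1
    rw [inner_add_right]
    module

theorem const_smul (hv : IsDampedFlow G k v) (c : ℂ) : IsDampedFlow G k fun t => c • v t where
  continuousOn := hv.continuousOn.const_smul c
  hasDerivWithinAt t ht := by
    convert! (hv.hasDerivWithinAt t ht).const_smul c using 1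
    rw [inner_smul_right]
    module

theorem hasDerivWithinAt_norm_sq (hv : IsDampedFlow G k v) {t : ℝ} (ht : 0 ≤ t) :
    HasDerivWithinAt (fun t => ‖v t‖ ^ 2) (-(2 * k * ‖inner ℂ (G t) (v t)‖ ^ 2)) (Set.Ici t) t := by
  have h := (hv.hasDerivWithinAt t ht).inner ℂ (hv.hasDerivWithinAt t ht)
  have h2 := (Complex.reCLM.hasFDerivAt.comp_hasDerivWithinAt t h)
  convert! h2 using 1
  · ext r
    simpa using (inner_self_eq_norm_sq (𝕜 := ℂ) (v r)).symm
  · set y := inner ℂ (G t) (v t) with hy'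
    have hy : inner ℂ (v t) (G t) = (starRingEnd ℂ) y := (inner_conj_symm _ _).symm
    simp only [inner_neg_left, inner_neg_right, inner_smul_left, inner_smul_right, hy,
      Complex.conj_ofReal]
    simp only [← Complex.normSq_eq_norm_sq, Complex.normSq_apply]
    clear_value y
    simp [← hy']
    ring

theorem continuousOn_Icc (hv : IsDampedFlow G k v) {a b : ℝ} (ha : 0 ≤ a) :
    ContinuousOn v (Set.Icc a b) :=
  hv.continuousOn.mono fun _ hx => ha.trans hx.1

theorem norm_sq_sub_ge (hv : IsDampedFlow G k v) {a b m : ℝ} (ha : 0 ≤ a) (hab : a ≤ b)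
    (hm : ∀ t ∈ Set.Ico a b, m ≤ 2 * k * ‖inner ℂ (G t) (v t)‖ ^ 2) :
    m * (b - a) ≤ ‖v a‖ ^ 2 - ‖v b‖ ^ 2 := by
  have h := image_le_of_deriv_right_le_deriv_boundary (f := fun t => ‖v t‖ ^ 2) (a := a) (b := b)
    (B := fun t => ‖v a‖ ^ 2 - m * (t - a)) (B' := fun _ => -m)
    ((hv.continuousOn_Icc ha).norm.pow 2)
    (fun t ht => hv.hasDerivWithinAt_norm_sq (ha.trans ht.1)) (by simp)
    (by fun_prop) (fun t _ => by
      have : HasDerivAt (fun t => ‖v a‖ ^ 2 - m * (t - a)) (-m) t := by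
        simpa using (((hasDerivAt_id t).sub_const a).const_mul m).const_sub (‖v a‖ ^ 2)
      exact this.hasDerivWithinAt) (fun t ht => neg_le_neg (hm t ht)) ⟨hab, le_rfl⟩
  linarith

theorem norm_le (hv : IsDampedFlow G k v) (hk : 0 ≤ k) {a b : ℝ} (ha : 0 ≤ a) (hab : a ≤ b) :
    ‖v b‖ ≤ ‖v a‖ := by
  have h := hv.norm_sq_sub_ge (m := 0) ha hab fun t _ => by positivity
  rw [zero_mul, sub_nonneg] at h
  exact (pow_le_pow_iff_left₀ (norm_nonneg _) (norm_nonneg _) two_ne_zero).1 h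

/-- The difference is again a damped flow; it starts at `0` and its norm cannot grow. -/
theorem eq_of_eq_zero (hv : IsDampedFlow G k v) (hw : IsDampedFlow G k w) (hk : 0 ≤ k)
    (h0 : v 0 = w 0) {t : ℝ} (ht : 0 ≤ t) : v t = w t := by
  have h := (hv.add (hw.const_smul (-1))).norm_le hk le_rfl ht
  simp only [h0, neg_smul, one_smul, add_neg_cancel, norm_zero, norm_le_zero_iff] at h
  rwa [add_neg_eq_zero] at h

/-- With `y = |⟨G, v⟩|` the speed is at most `kMy`, which by Young's inequality is at most `e +
k²M²y²/(4e)`. The second term is `kM²/(8e)` times the dissipation rate `2ky²`, so it integrates to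
energy loss. Linear growth in time costs only the arbitrarily small factor `e`. -/
theorem norm_sub_le_of_pos (hv : IsDampedFlow G k v) (hk : 0 ≤ k) {M : ℝ} (hM : ∀ t, ‖G t‖ ≤ M)
    {e : ℝ} (he : 0 < e) {a b : ℝ} (ha : 0 ≤ a) (hab : a ≤ b) :
    ‖v b - v a‖ ≤ e * (b - a) + k * M ^ 2 / (8 * e) * (‖v a‖ ^ 2 - ‖v b‖ ^ 2) := by
  refine image_norm_le_of_norm_deriv_right_le_deriv_boundary' (f := fun t => v t - v a)
    (B := fun t => e * (t - a) + k * M ^ 2 / (8 * e) * (‖v a‖ ^ 2 - ‖v t‖ ^ 2))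
    (B' := fun t => e * 1 + k * M ^ 2 / (8 * e) * (- -(2 * k * ‖inner ℂ (G t) (v t)‖ ^ 2)))
    ((hv.continuousOn_Icc ha).sub continuousOn_const)
    (fun t ht => (hv.hasDerivWithinAt t (ha.trans ht.1)).sub_const _) (by simp) ?_ ?_ ?_
    ⟨hab, le_rfl⟩
  · have := hv.continuousOn_Icc ha (b := b)
    fun_prop
  · intro t ht
    exact (((hasDerivAt_id t).sub_const a).hasDerivWithinAt.const_mul e).add
      (((hv.hasDerivWithinAt_norm_sq (ha.trans ht.1)).const_sub _).const_mul _)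
  · intro t _
    set y := ‖inner ℂ (G t) (v t)‖
    have hM0 : 0 ≤ M := (norm_nonneg _).trans (hM t)
    have h1 : ‖-((k : ℂ) • inner ℂ (G t) (v t) • G t)‖ ≤ k * (y * M) := by
      rw [norm_neg, norm_smul, norm_smul, Complex.norm_real, Real.norm_of_nonneg hk]
      gcongr
      exact hM t
    refine h1.trans ?_
    have h2 : e * 1 + k * M ^ 2 / (8 * e) * (- -(2 * k * y ^ 2)) - k * (y * M) =
        (e - k * M * y / 2) ^ 2 / e := by
      field_simp
      ring
    have h3 : 0 ≤ (e - k * M * y / 2) ^ 2 / e := by positivity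
    linarith

theorem norm_sub_le (hv : IsDampedFlow G k v) (hk : 0 ≤ k) {M : ℝ} (hM : ∀ t, ‖G t‖ ≤ M)
    {a b : ℝ} (ha : 0 ≤ a) (hab : a ≤ b) :
    ‖v b - v a‖ ≤ k * (M * ‖v 0‖ * M) * (b - a) := by
  refine norm_image_sub_le_of_norm_deriv_right_le_segment (hv.continuousOn_Icc ha)
    (fun t ht => hv.hasDerivWithinAt t (ha.trans ht.1)) (fun t ht => ?_) b ⟨hab, le_rfl⟩
  have hM0 : 0 ≤ M := (norm_nonneg _).trans (hM t)
  rw [norm_neg, norm_smul, norm_smul, Complex.norm_real, Real.norm_of_nonneg hk]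
  gcongr
  · refine (norm_inner_le_norm _ _).trans ?_
    gcongr
    · exact hM t
    · exact hv.norm_le hk le_rfl (ha.trans ht.1)
  · exact hM t

theorem exists_tendsto_norm_sq (hv : IsDampedFlow G k v) (hk : 0 ≤ k) :
    ∃ l : ℝ, Tendsto (fun t => ‖v t‖ ^ 2) atTop (𝓝 l) := by
  have hanti : Antitone fun t => ‖v (max t 0)‖ ^ 2 := by
    intro a b hab
    have := hv.norm_le hk (le_max_right a 0) (max_le_max_right 0 hab)
    simp only
    gcongr
  have hbdd : BddBelow (Set.range fun t => ‖v (max t 0)‖ ^ 2) :=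
    ⟨0, by rintro _ ⟨t, rfl⟩; positivity⟩
  refine ⟨_, (tendsto_atTop_ciInf hanti hbdd).congr' ?_⟩
  filter_upwards [eventually_ge_atTop 0] with t ht
  rw [max_eq_left ht]

theorem tendsto_norm_sq_sub (hv : IsDampedFlow G k v) (hk : 0 ≤ k) (s : ℝ) :
    Tendsto (fun t => ‖v t‖ ^ 2 - ‖v (t + s)‖ ^ 2) atTop (𝓝 0) := by
  obtain ⟨l, hl⟩ := hv.exists_tendsto_norm_sq hk
  simpa using hl.sub (hl.comp (tendsto_atTop_add_const_right _ s tendsto_id))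

/-- The flow is asymptotically stationary. -/
theorem tendsto_sub (hv : IsDampedFlow G k v) (hk : 0 ≤ k) {M : ℝ} (hM : ∀ t, ‖G t‖ ≤ M)
    {s : ℝ} (hs : 0 ≤ s) : Tendsto (fun t => v (t + s) - v t) atTop (𝓝 0) := by
  rw [Metric.tendsto_nhds]
  intro ε hε
  -- This keeps `e * s < ε`; the remaining term is a multiple of the energy lost on `[t, t + s]`,
  -- which tends to `0`.
  set e := ε / (2 * (s + 1)) with he
  have he0 : 0 < e := by positivity
  have h1 : e * s < ε := by
    rw [he, div_mul_eq_mul_div, div_lt_iff₀ (by positivity)]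
    nlinarith
  have h2 : Tendsto (fun t => e * s + k * M ^ 2 / (8 * e) * (‖v t‖ ^ 2 - ‖v (t + s)‖ ^ 2)) atTop
      (𝓝 (e * s)) := by
    simpa using ((hv.tendsto_norm_sq_sub hk s).const_mul (k * M ^ 2 / (8 * e))).const_add (e * s)
  filter_upwards [h2.eventually (gt_mem_nhds h1), eventually_ge_atTop 0] with t ht ht0
  rw [dist_zero_right]
  have h3 := hv.norm_sub_le_of_pos hk hM he0 ht0 (le_add_of_nonneg_right hs)
  rw [add_sub_cancel_left] at h3
  exact h3.trans_lt ht

theorem exists_flow [CompleteSpace Z] (hG : Continuous G) {M : ℝ} (hM : ∀ t, ‖G t‖ ≤ M) (k : ℝ)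
    (x : Z) : ∃ v, v 0 = x ∧ IsDampedFlow G k v := by
  have hM0 : 0 ≤ M := (norm_nonneg _).trans (hM 0)
  let f : ℝ → Z →L[ℂ] Z := fun t => -((k : ℂ) • (innerSL ℂ (G t)).smulRight (G t))
  have hfa : ∀ t z, f t z = -((k : ℂ) • inner ℂ (G t) z • G t) := fun t z => by simp [f]
  have hf : Continuous fun p : ℝ × Z => f p.1 p.2 := by
    simp only [hfa]
    fun_prop
  have hC : ∀ t, ‖f t‖ ≤ |k| * (M * M) := by
    intro t
    refine ContinuousLinearMap.opNorm_le_bound _ (by positivity) fun z => ?_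
    rw [hfa, norm_neg, norm_smul, norm_smul, Complex.norm_real, Real.norm_eq_abs]
    have h1 : ‖inner ℂ (G t) z‖ ≤ M * ‖z‖ :=
      (norm_inner_le_norm _ _).trans (mul_le_mul_of_nonneg_right (hM t) (norm_nonneg _))
    calc |k| * (‖inner ℂ (G t) z‖ * ‖G t‖) ≤ |k| * (M * ‖z‖ * M) := by
          gcongr
          exact hM t
      _ = _ := by ring
  obtain ⟨v, h0, hv⟩ := exists_forall_hasDerivAt_linear hf hC x
  refine ⟨v, h0, continuousOn_of_forall_continuousAt fun t _ => (hv t).continuousAt, fun t _ => ?_⟩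
  rw [← hfa]
  exact (hv t).hasDerivWithinAt

end IsDampedFlow

end DampedFlow

/-! ### Unitarity of the open-loop semigroup and its adjoint orbits. -/

section Unitary

variable {Z : Type*} [NormedAddCommGroup Z] [InnerProductSpace ℂ Z]

theorem tendsto_apply_of_norm_le {ι : Type*} {l : Filter ι} {L : ι → Z →L[ℂ] Z} {u : ι → Z}
    {x y : Z} (hL : ∀ i z, ‖L i z‖ ≤ ‖z‖) (hx : Tendsto (fun i => L i x) l (𝓝 y))
    (hu : Tendsto u l (𝓝 x)) : Tendsto (fun i => L i (u i)) l (𝓝 y) := by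
  have h1 : Tendsto (fun i => L i (u i - x)) l (𝓝 0) :=
    squeeze_zero_norm (fun i => hL i _) (tendsto_iff_norm_sub_tendsto_zero.1 hu)
  simpa using h1.add hx

variable [CompleteSpace Z]

/-- Every operator of the semigroup is unitary. -/
structure C0Semigroup.IsUnitary (S : C0Semigroup Z) : Prop where
  adjoint_apply_apply : ∀ t x, ContinuousLinearMap.adjoint (S.toFun t) (S.toFun t x) = x
  apply_adjoint_apply : ∀ t x, S.toFun t (ContinuousLinearMap.adjoint (S.toFun t) x) = x

/-- An isometry has closed range; this range contains each eigenvector `y`, the image of `e^{-lt}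
y`, and so is everything. -/
theorem IsSystem.isUnitary {A : Z →ₗ.[ℂ] Z} {B : ℂ →L[ℂ] Z} {C : Z →L[ℂ] ℂ}
    (h : IsSystem A B C) (hA : IsSkewAdjoint A) {S : C0Semigroup Z} (hS : S.IsGenerator A) :
    S.IsUnitary := by
  have h1 : ∀ t x, ContinuousLinearMap.adjoint (S.toFun t) (S.toFun t x) = x := by
    intro t x
    have := (ContinuousLinearMap.norm_map_iff_adjoint_comp_self (S.toFun t)).1
      (hA.norm_semigroup_apply hS t)
    exact congrArg (fun Q : Z →L[ℂ] Z => Q x) this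
  refine ⟨h1, fun t x => ?_⟩
  have hiso : Isometry (S.toFun t) :=
    AddMonoidHomClass.isometry_of_norm _ (hA.norm_semigroup_apply hS t)
  have htop := h.eq_top_of_eigenvectors_mem hA (LinearMap.range (S.toFun t : Z →ₗ[ℂ] Z))
    (by
      rw [LinearMap.coe_range]
      exact hiso.isClosedEmbedding.isClosed_range) (fun y l hy => by
      refine ⟨Complex.exp (-(l * (t : ℝ))) • (y : Z), ?_⟩
      simp only [ContinuousLinearMap.coe_coe, map_smul]
      rw [hS.apply_eigenvector hy, smul_smul, ← Complex.exp_add]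
      simp)
  obtain ⟨y, rfl⟩ : x ∈ LinearMap.range (S.toFun t : Z →ₗ[ℂ] Z) := htop ▸ Submodule.mem_top
  simp only [ContinuousLinearMap.coe_coe, h1]

namespace C0Semigroup

variable {S : C0Semigroup Z}

namespace IsUnitary

theorem norm_apply (hS : S.IsUnitary) (t : ℝ≥0) (x : Z) : ‖S.toFun t x‖ = ‖x‖ :=
  (ContinuousLinearMap.norm_map_iff_adjoint_comp_self (S.toFun t)).2
    (ContinuousLinearMap.ext fun x => hS.adjoint_apply_apply t x) x

theorem norm_adjoint_apply (hS : S.IsUnitary) (t : ℝ≥0) (x : Z) :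
    ‖ContinuousLinearMap.adjoint (S.toFun t) x‖ = ‖x‖ := by
  rw [← hS.norm_apply t, hS.apply_adjoint_apply]

theorem continuous_adjoint_apply (hS : S.IsUnitary) (x : Z) :
    Continuous fun t => ContinuousLinearMap.adjoint (S.toFun t) x := by
  rw [continuous_iff_continuousAt]
  intro t
  set y := ContinuousLinearMap.adjoint (S.toFun t) x with hy
  have h1 : Tendsto (fun r => ‖S.toFun r y - S.toFun t y‖) (𝓝 t) (𝓝 0) :=
    tendsto_iff_norm_sub_tendsto_zero.1 ((S.continuous_apply y).tendsto t)
  refine tendsto_iff_norm_sub_tendsto_zero.2 (h1.congr fun r => ?_)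
  change _ = ‖ContinuousLinearMap.adjoint (S.toFun r) x - y‖
  rw [← hS.norm_apply r (_ - y), map_sub, hS.apply_adjoint_apply, ← norm_neg, neg_sub,
    hy, hS.apply_adjoint_apply]

end IsUnitary

theorem adjoint_add_apply (S : C0Semigroup Z) (s t : ℝ≥0) (x : Z) :
    ContinuousLinearMap.adjoint (S.toFun (s + t)) x =
      ContinuousLinearMap.adjoint (S.toFun t) (ContinuousLinearMap.adjoint (S.toFun s) x) := by
  rw [S.map_add, ContinuousLinearMap.adjoint_comp]
  rfl

/-- The orbit of `b` under the adjoint semigroup, constant for negative times. -/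
noncomputable def adjointOrbit (S : C0Semigroup Z) (b : Z) (t : ℝ) : Z :=
  ContinuousLinearMap.adjoint (S.toFun t.toNNReal) b

theorem IsUnitary.continuous_adjointOrbit (hS : S.IsUnitary) (b : Z) :
    Continuous (S.adjointOrbit b) :=
  (hS.continuous_adjoint_apply b).comp continuous_real_toNNReal

theorem IsUnitary.norm_adjointOrbit_le (hS : S.IsUnitary) (b : Z) (t : ℝ) :
    ‖S.adjointOrbit b t‖ ≤ ‖b‖ := (hS.norm_adjoint_apply _ b).le

end C0Semigroup

end Unitary

/-! ### The closed-loop semigroup and the interaction picture. -/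

section ClosedLoop

variable {Z : Type*} [NormedAddCommGroup Z] [InnerProductSpace ℂ Z] [CompleteSpace Z]
  {A : Z →ₗ.[ℂ] Z} {B : ℂ →L[ℂ] Z} {k : ℝ}

theorem exists_closedLoop_apply_eq_iff {x y : Z} :
    (∃ hx : x ∈ (closedLoop A B (ContinuousLinearMap.adjoint B) k).domain,
      closedLoop A B (ContinuousLinearMap.adjoint B) k ⟨x, hx⟩ = y) ↔
      ∃ hx : x ∈ A.domain, A ⟨x, hx⟩ = y + (k : ℂ) • inner ℂ (B 1) x • B 1 := by
  have h1 : ContinuousLinearMap.adjoint B x = inner ℂ (B 1) x := by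
    rw [← ContinuousLinearMap.adjoint_inner_right]
    simp
  have h2 : B (inner ℂ (B 1) x) = inner ℂ (B 1) x • B 1 := by
    rw [← map_smul, smul_eq_mul, mul_one]
  rw [← h2, ← h1]
  exact exists_congr fun hx => sub_eq_iff_eq_add

variable {S : C0Semigroup Z}

namespace C0Semigroup

/-- Translates of a damped flow, moved by the unitary semigroup, are damped flows. -/
theorem IsUnitary.isDampedFlow_translate (hS : S.IsUnitary) {b : Z} {v : ℝ → Z}
    (hv : IsDampedFlow (S.adjointOrbit b) k v) (s : ℝ≥0) :
    IsDampedFlow (S.adjointOrbit b) k fun t => S.toFun s (v (t + s)) where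
  continuousOn := by
    refine (S.toFun s).continuous.comp_continuousOn (hv.continuousOn.comp (by fun_prop) ?_)
    intro t ht
    exact add_nonneg ht s.coe_nonneg
  hasDerivWithinAt t ht := by
    have h1 := hv.hasDerivWithinAt (t + s) (add_nonneg ht s.coe_nonneg)
    rw [hasDerivWithinAt_Ici_iff_tendsto_nnreal] at h1 ⊢
    have h2 := ((S.toFun s).continuous.tendsto _).comp h1
    have h3 : S.toFun s (S.adjointOrbit b (t + s)) = S.adjointOrbit b t := by
      rw [adjointOrbit, Real.toNNReal_add ht s.coe_nonneg, Real.toNNReal_coe, S.adjoint_add_apply,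
        hS.apply_adjoint_apply]
      rfl
    have h4 : inner ℂ (S.adjointOrbit b (t + s)) (v (t + s)) =
        inner ℂ (S.adjointOrbit b t) (S.toFun s (v (t + s))) := by
      rw [adjointOrbit, Real.toNNReal_add ht s.coe_nonneg, Real.toNNReal_coe, S.adjoint_add_apply,
        ContinuousLinearMap.adjoint_inner_left]
      rfl
    rw [h4, map_neg, map_smul, map_smul, h3] at h2
    refine h2.congr fun h => ?_
    simp only [Function.comp_apply, map_smul, map_sub, add_right_comm]

/-- The semigroup `z ↦ S t (v t)`, where `v` is the damped flow starting at `z`. -/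
theorem IsUnitary.exists_damped (hS : S.IsUnitary) (b : Z) (hk : 0 ≤ k) :
    ∃ T : C0Semigroup Z, ∀ z, ∃ v : ℝ → Z, v 0 = z ∧ IsDampedFlow (S.adjointOrbit b) k v ∧
      ∀ t : ℝ≥0, T.toFun t z = S.toFun t (v t) := by
  choose v hv0 hv using fun z => IsDampedFlow.exists_flow (hS.continuous_adjointOrbit b)
    (hS.norm_adjointOrbit_le b) k z
  have hadd : ∀ (t : ℝ≥0) (y z : Z), v (y + z) t = v y t + v z t := fun t y z =>
    (hv (y + z)).eq_of_eq_zero ((hv y).add (hv z)) hk (by simp [hv0]) t.coe_nonneg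
  have hsmul : ∀ (t : ℝ≥0) (c : ℂ) (z : Z), v (c • z) t = c • v z t := fun t c z =>
    (hv (c • z)).eq_of_eq_zero ((hv z).const_smul c) hk (by simp [hv0]) t.coe_nonneg
  let L : ℝ≥0 → Z →L[ℂ] Z := fun t => LinearMap.mkContinuous
    { toFun := fun z => S.toFun t (v z t)
      map_add' := fun y z => by rw [hadd, _root_.map_add]
      map_smul' := fun c z => by rw [hsmul, map_smul, RingHom.id_apply] } 1 fun z => by
    rw [one_mul]
    simp only [LinearMap.coe_mk, AddHom.coe_mk, hS.norm_apply]
    have := (hv z).norm_le hk le_rfl t.coe_nonneg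
    rwa [hv0] at this
  have hL : ∀ t z, L t z = S.toFun t (v z t) := fun t z => rfl
  refine ⟨⟨L, ?_, ?_, ?_⟩, fun z => ⟨v z, hv0 z, hv z, fun t => rfl⟩⟩
  · ext z
    simp [hL, S.map_zero, hv0]
  · intro s t
    ext z
    rw [ContinuousLinearMap.comp_apply, hL, hL, hL, S.map_add_apply]
    -- The semigroup law is uniqueness: `s ↦ S(t) v(s + t)` is the damped flow starting at `S(t)
    -- v(t)`.
    have := (hS.isDampedFlow_translate (hv z) t).eq_of_eq_zero (hv (S.toFun t (v z t))) hk
      (by simp [hv0]) s.coe_nonneg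
    rw [NNReal.coe_add, this]
  · intro z
    refine tendsto_apply_of_norm_le (L := S.toFun) (fun t z => (hS.norm_apply t z).le) (S.tendsto_zero z) ?_
    have h1 : Tendsto (fun t : ℝ≥0 => (t : ℝ)) (𝓝 0) (𝓝[Set.Ici 0] 0) :=
      tendsto_nhdsWithin_iff.2 ⟨by simpa using NNReal.continuous_coe.tendsto 0,
        .of_forall fun t => t.2⟩
    have h2 := ((hv z).continuousOn 0 (by simp)).tendsto.comp h1
    rwa [hv0] at h2

/-- The difference quotient of `T` is that of `S` plus `S(h)((v(h) - x)/h)`, and the latter always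
tends to `-k ⟨b, x⟩ b`; so one quotient converges exactly when the other does. -/
theorem IsUnitary.exists_isGenerator_closedLoop (hS : S.IsUnitary) (hA : S.IsGenerator A)
    (hk : 0 ≤ k) :
    ∃ T : C0Semigroup Z, T.IsGenerator (closedLoop A B (ContinuousLinearMap.adjoint B) k) := by
  obtain ⟨T, hT⟩ := hS.exists_damped (B 1) hk
  refine ⟨T, fun x y => ?_⟩
  set w := (k : ℂ) • inner ℂ (B 1) x • B 1 with hw
  rw [exists_closedLoop_apply_eq_iff, hA, ← hw]
  obtain ⟨v, hv0, hv, hTv⟩ := hT x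
  have h2 : Tendsto (fun h : ℝ≥0 => S.toFun h (((h : ℝ) : ℂ)⁻¹ • (v h - x))) (𝓝[>] 0)
      (𝓝 (-w)) := by
    refine tendsto_apply_of_norm_le (L := S.toFun) (fun t z => (hS.norm_apply t z).le)
      ((S.tendsto_zero _).mono_left nhdsWithin_le_nhds) ?_
    have h3 := hasDerivWithinAt_Ici_iff_tendsto_nnreal.1 (hv.hasDerivWithinAt 0 le_rfl)
    have h4 : S.adjointOrbit (B 1) 0 = B 1 := by
      simp [adjointOrbit, S.map_zero, ContinuousLinearMap.adjoint_id]
    simpa only [hv0, h4, zero_add] using h3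
  have h5 : ∀ h : ℝ≥0, ((h : ℝ) : ℂ)⁻¹ • (T.toFun h x - x) =
      ((h : ℝ) : ℂ)⁻¹ • (S.toFun h x - x) + S.toFun h (((h : ℝ) : ℂ)⁻¹ • (v h - x)) := by
    intro h
    rw [map_smul, ← smul_add, map_sub, hTv]
    congr 1
    abel
  constructor
  · intro h
    simpa only [h5, add_neg_cancel_right] using h.add h2
  · intro h
    simpa only [h5, add_sub_cancel_right, sub_neg_eq_add] using h.sub h2

/-- Orbits of the closed-loop semigroup satisfy the damped equation in the interaction picture. -/
theorem IsGenerator.isDampedFlow {T : C0Semigroup Z}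
    (hT : T.IsGenerator (closedLoop A B (ContinuousLinearMap.adjoint B) k))
    (hS : S.IsUnitary) (hA : S.IsGenerator A) (x : A.domain) :
    IsDampedFlow (S.adjointOrbit (B 1)) k fun t =>
      ContinuousLinearMap.adjoint (S.toFun t.toNNReal) (T.toFun t.toNNReal x) where
  continuousOn := by
    refine Continuous.continuousOn (continuous_iff_continuousAt.2 fun t => ?_)
    exact tendsto_apply_of_norm_le (fun t z => (hS.norm_adjoint_apply _ z).le)
      (((hS.continuous_adjoint_apply _).comp continuous_real_toNNReal).tendsto t)
      ((T.continuous_toNNReal_apply _).tendsto t)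
  hasDerivWithinAt t ht := by
    obtain ⟨hz, -⟩ : ∃ hz : T.toFun t.toNNReal x ∈ A.domain, _ := hT.exists_apply_eq t.toNNReal x
    set z := T.toFun t.toNNReal x with hzdef
    have hTz := (hT z (A ⟨z, hz⟩ - (k : ℂ) • inner ℂ (B 1) z • B 1)).1
      (exists_closedLoop_apply_eq_iff.2 ⟨hz, (sub_add_cancel _ _).symm⟩)
    -- At `z = T(t)x ∈ D(A)` the unbounded parts of the two generators cancel, leaving `-k ⟨b, z⟩
    -- b`.
    have h1 := hTz.sub (hA.tendsto ⟨z, hz⟩)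
    rw [sub_sub_cancel_left] at h1
    have h2 := tendsto_apply_of_norm_le
      (L := fun h : ℝ≥0 => ContinuousLinearMap.adjoint (S.toFun h))
      (fun t z => (hS.norm_adjoint_apply t z).le)
      (((hS.continuous_adjoint_apply _).tendsto 0).mono_left nhdsWithin_le_nhds) h1
    have h3 := ((ContinuousLinearMap.adjoint (S.toFun t.toNNReal)).continuous.tendsto _).comp h2
    have h4 : inner ℂ (S.adjointOrbit (B 1) t)
        (ContinuousLinearMap.adjoint (S.toFun t.toNNReal) z) = inner ℂ (B 1) z := by
      rw [adjointOrbit, ContinuousLinearMap.adjoint_inner_left, hS.apply_adjoint_apply]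
    rw [hasDerivWithinAt_Ici_iff_tendsto_nnreal, h4]
    simp only [S.map_zero, ContinuousLinearMap.adjoint_id, ContinuousLinearMap.id_apply, map_neg,
      map_smul] at h3
    refine h3.congr fun h => ?_
    rw [Real.toNNReal_add ht h.coe_nonneg, Real.toNNReal_coe, add_comm t.toNNReal h, S.adjoint_add_apply,
      T.map_add_apply, ← hzdef]
    simp only [Function.comp_apply, ← smul_sub, map_smul, sub_sub_sub_cancel_right, map_sub,
      hS.adjoint_apply_apply]

end C0Semigroup

end ClosedLoop

/-! ### Vanishing output, weak convergence and strong stability. -/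

section Stability

variable {Z : Type*} [NormedAddCommGroup Z] [InnerProductSpace ℂ Z] [CompleteSpace Z]
  {S : C0Semigroup Z} {b : Z} {k : ℝ} {v : ℝ → Z}

theorem C0Semigroup.adjointOrbit_zero (S : C0Semigroup Z) (b : Z) : S.adjointOrbit b 0 = b := by
  simp [C0Semigroup.adjointOrbit, S.map_zero, ContinuousLinearMap.adjoint_id]

theorem C0Semigroup.adjointOrbit_add (S : C0Semigroup Z) (b : Z) {t r : ℝ} (ht : 0 ≤ t)
    (hr : 0 ≤ r) : S.adjointOrbit b (t + r) =
      ContinuousLinearMap.adjoint (S.toFun t.toNNReal) (S.adjointOrbit b r) := by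
  rw [adjointOrbit, Real.toNNReal_add ht hr, add_comm, S.adjoint_add_apply, adjointOrbit]

/-- The output of the damped flow tends to zero. -/
theorem IsDampedFlow.tendsto_output (hv : IsDampedFlow (S.adjointOrbit b) k v)
    (hS : S.IsUnitary) (hk : 0 < k) :
    Tendsto (fun t => inner ℂ (S.adjointOrbit b t) (v t)) atTop (𝓝 0) := by
  set G := S.adjointOrbit b with hG
  have hM : ∀ t, ‖G t‖ ≤ ‖b‖ := hS.norm_adjointOrbit_le b
  have hGc : Continuous G := hS.continuous_adjointOrbit b
  -- A modulus of continuity for the output, uniform in `t`. If the output had size `ε` at a late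
  -- time, it would exceed `ε / 2` for a further time `δ / 2` and cost a fixed amount of energy, yet
  -- the energy converges.
  set g : ℝ → ℝ := fun r => ‖b‖ * (k * (‖b‖ * ‖v 0‖ * ‖b‖) * r) + ‖G r - b‖ * ‖v 0‖ with hg
  have hgc : Continuous g := by fun_prop
  have hg0 : g 0 = 0 := by simp [hg, hG, S.adjointOrbit_zero]
  have hmod : ∀ t r : ℝ, 0 ≤ t → 0 ≤ r →
      ‖inner ℂ (G (t + r)) (v (t + r)) - inner ℂ (G t) (v t)‖ ≤ g r := by
    intro t r ht hr
    have h1 : inner ℂ (G (t + r)) (v (t + r)) - inner ℂ (G t) (v t) =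
        inner ℂ (G (t + r)) (v (t + r) - v t) + inner ℂ (G (t + r) - G t) (v t) := by
      rw [inner_sub_left, inner_sub_right]
      ring
    have h2 : ‖G (t + r) - G t‖ = ‖G r - b‖ := by
      have h3 : G t = ContinuousLinearMap.adjoint (S.toFun t.toNNReal) b := rfl
      rw [h3, hG, S.adjointOrbit_add b ht hr, ← map_sub, hS.norm_adjoint_apply]
    rw [h1]
    refine (norm_add_le _ _).trans (add_le_add ((norm_inner_le_norm _ _).trans ?_)
      ((norm_inner_le_norm _ _).trans ?_))
    · have := hv.norm_sub_le hk.le hM ht (le_add_of_nonneg_right hr)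
      rw [add_sub_cancel_left] at this
      gcongr
      exact hM _
    · rw [h2]
      gcongr
      exact hv.norm_le hk.le le_rfl ht
  rw [Metric.tendsto_nhds]
  intro ε hε
  obtain ⟨δ, hδ, hgδ⟩ := Metric.continuousAt_iff.1 (hgc.continuousAt (x := 0)) (ε / 2) (by positivity)
  have hm : 0 < 2 * k * (ε / 2) ^ 2 * (δ / 2) := by positivity
  filter_upwards [(hv.tendsto_norm_sq_sub hk.le (δ / 2)).eventually (gt_mem_nhds hm),
    eventually_ge_atTop 0] with t ht ht0
  rw [dist_zero_right]
  by_contra! hcon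
  have h4 := hv.norm_sq_sub_ge (m := 2 * k * (ε / 2) ^ 2) ht0 (b := t + δ / 2) (by linarith)
    fun r hr => by
      have h5 := hmod t (r - t) ht0 (sub_nonneg.2 hr.1)
      rw [add_sub_cancel] at h5
      have h6 : g (r - t) < ε / 2 := by
        have h7 : dist (r - t) 0 < δ := by
          rw [Real.dist_0_eq_abs, abs_of_nonneg (sub_nonneg.2 hr.1)]
          linarith [hr.2]
        have h8 := hgδ h7
        rw [hg0, Real.dist_0_eq_abs] at h8
        exact (le_abs_self _).trans_lt h8
      have h9 : ε / 2 ≤ ‖inner ℂ (G r) (v r)‖ := by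
        have := norm_sub_norm_le (inner ℂ (G t) (v t)) (inner ℂ (G r) (v r))
        rw [norm_sub_rev] at this
        linarith
      gcongr
  rw [add_sub_cancel_left] at h4
  linarith

/-- The vectors that an orbit becomes orthogonal to as time tends to infinity. -/
def weakNull (z : ℝ≥0 → Z) : Submodule ℂ Z where
  carrier := {g | Tendsto (fun t => inner ℂ g (z t)) atTop (𝓝 0)}
  zero_mem' := by simp
  add_mem' {g h} hg hh := by
    simpa [inner_add_left] using Tendsto.add (show Tendsto _ _ _ from hg) hh
  smul_mem' c g hg := by
    simpa [inner_smul_left] using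
      Tendsto.mul_const (starRingEnd ℂ c) (show Tendsto _ _ _ from hg)

omit [CompleteSpace Z] in
theorem mem_weakNull {z : ℝ≥0 → Z} {g : Z} :
    g ∈ weakNull z ↔ Tendsto (fun t => inner ℂ g (z t)) atTop (𝓝 0) := Iff.rfl

omit [CompleteSpace Z] in
theorem isClosed_weakNull {z : ℝ≥0 → Z} {C : ℝ} (hC : ∀ t, ‖z t‖ ≤ C) :
    IsClosed (weakNull z : Set Z) := by
  have hC0 : 0 ≤ C := (norm_nonneg _).trans (hC 0)
  refine isClosed_of_closure_subset fun g hg => ?_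
  rw [SetLike.mem_coe, mem_weakNull, Metric.tendsto_nhds]
  intro ε hε
  obtain ⟨h, hh, hgh⟩ := Metric.mem_closure_iff.1 hg (ε / (2 * (C + 1))) (by positivity)
  have hh : Tendsto (fun t => inner ℂ h (z t)) atTop (𝓝 0) := hh
  filter_upwards [Metric.tendsto_nhds.1 hh (ε / 2) (half_pos hε)] with t ht
  rw [dist_zero_right] at ht ⊢
  have h1 : inner ℂ g (z t) = inner ℂ (g - h) (z t) + inner ℂ h (z t) := by
    rw [inner_sub_left, sub_add_cancel]
  have h2 : ‖inner ℂ (g - h) (z t)‖ ≤ ε / 2 := by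
    refine (norm_inner_le_norm _ _).trans ?_
    rw [dist_eq_norm] at hgh
    calc ‖g - h‖ * ‖z t‖ ≤ ε / (2 * (C + 1)) * (C + 1) := by
          gcongr
          linarith [hC t]
      _ = ε / 2 := by field_simp
  rw [h1]
  exact (norm_add_le _ _).trans_lt (by linarith)

section Invariance

variable {z : ℝ≥0 → Z} {s : ℝ≥0}

/-- `⟨S(s)* g, z(t)⟩ = ⟨g, S(s) z(t)⟩`, which is asymptotically `⟨g, z(t + s)⟩`. -/
theorem adjoint_mem_weakNull
    (hz : Tendsto (fun t => z (t + s) - S.toFun s (z t)) atTop (𝓝 0)) {g : Z}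
    (hg : g ∈ weakNull z) : ContinuousLinearMap.adjoint (S.toFun s) g ∈ weakNull z := by
  rw [mem_weakNull] at hg ⊢
  have h1 := hg.comp (tendsto_atTop_mono (fun t : ℝ≥0 => le_self_add (a := t) (b := s)) tendsto_id)
  have h2 := (tendsto_const_nhds (x := g)).inner (𝕜 := ℂ) hz
  rw [inner_zero_right] at h2
  have h3 := h1.sub h2
  rw [sub_zero] at h3
  refine h3.congr fun t => ?_
  simp [inner_sub_right, ContinuousLinearMap.adjoint_inner_left, sub_sub_cancel]

theorem C0Semigroup.IsUnitary.mem_weakNull (hS : S.IsUnitary)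
    (hz : Tendsto (fun t => z (t + s) - S.toFun s (z t)) atTop (𝓝 0)) {g : Z}
    (hg : g ∈ weakNull z) : S.toFun s g ∈ weakNull z := by
  rw [RootLocus.mem_weakNull] at hg ⊢
  have h2 := (tendsto_const_nhds (x := S.toFun s g)).inner (𝕜 := ℂ) hz
  rw [inner_zero_right] at h2
  have h3 := hg.add h2
  rw [add_zero] at h3
  have h4 : Tendsto (fun t : ℝ≥0 => t - s) atTop atTop :=
    tendsto_atTop.2 fun a => (eventually_ge_atTop (a + s)).mono fun t ht =>
      le_tsub_of_add_le_right ht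
  refine (h3.comp h4).congr' ?_
  filter_upwards [eventually_ge_atTop s] with t ht
  rw [Function.comp_apply, tsub_add_cancel_of_le ht, inner_sub_right,
    ← ContinuousLinearMap.adjoint_inner_right (S.toFun s) g (S.toFun s _), hS.adjoint_apply_apply]
  ring

end Invariance

/-- If a closed subspace reducing the semigroup contains `b`, and no eigenvector of the generator is
orthogonal to `b`, then the subspace contains all eigenvectors. -/
theorem eigenvector_mem_of_reducing {A : Z →ₗ.[ℂ] Z} (hA : S.IsGenerator A) {N : Submodule ℂ Z}
    (hN : IsClosed (N : Set Z)) (hSN : ∀ t, ∀ g ∈ N, S.toFun t g ∈ N)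
    (hSN' : ∀ t, ∀ g ∈ N, ContinuousLinearMap.adjoint (S.toFun t) g ∈ N) (hb : b ∈ N)
    (hobs : ∀ (x : A.domain) (l : ℂ), A x = l • (x : Z) → inner ℂ b (x : Z) = 0 → (x : Z) = 0)
    {x : A.domain} {l : ℂ} (hx : A x = l • (x : Z)) : (x : Z) ∈ N := by
  have : CompleteSpace N := hN.completeSpace_coe
  obtain ⟨p, hp, q, hq, hpq⟩ := N.exists_add_mem_mem_orthogonal (x : Z)
  have hSq : ∀ t : ℝ≥0, S.toFun t q = Complex.exp (l * (t : ℝ)) • q := by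
    intro t
    have h1 := hA.apply_eigenvector hx t
    rw [hpq, _root_.map_add, smul_add] at h1
    -- The defect of `q` from being an eigenvector is minus that of `p`; it lies in both `Nᗮ` and
    -- `N`, hence vanishes. So `q` is an eigenvector or zero, orthogonal to `b`.
    have h2 : S.toFun t q - Complex.exp (l * (t : ℝ)) • q =
        Complex.exp (l * (t : ℝ)) • p - S.toFun t p := by
      rw [sub_eq_sub_iff_add_eq_add, add_comm, h1, add_comm]
    have h3 : S.toFun t q ∈ Nᗮ := by
      rw [Submodule.mem_orthogonal]
      intro u hu
      rw [← ContinuousLinearMap.adjoint_inner_left]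
      exact (Submodule.mem_orthogonal _ _).1 hq _ (hSN' t u hu)
    have h4 : S.toFun t q - Complex.exp (l * (t : ℝ)) • q ∈ Nᗮ :=
      Nᗮ.sub_mem h3 (Nᗮ.smul_mem _ hq)
    have h5 : S.toFun t q - Complex.exp (l * (t : ℝ)) • q ∈ N := by
      rw [h2]
      exact N.sub_mem (N.smul_mem _ hp) (hSN t p hp)
    exact sub_eq_zero.1 (inner_self_eq_zero.1 ((Submodule.mem_orthogonal _ _).1 h4 _ h5))
  obtain ⟨hqd, hAq⟩ := hA.apply_eq_of_semigroup_eigenvector hSq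
  have hq0 : q = 0 := hobs ⟨q, hqd⟩ l hAq ((Submodule.mem_orthogonal _ _).1 hq b hb)
  rw [hpq, hq0, add_zero]
  exact hp

omit [CompleteSpace Z] in
/-- A weakly null family inside a compact set converges to zero in norm. -/
theorem tendsto_zero_of_weakNull_eq_top {z : ℝ≥0 → Z} {K : Set Z} (hK : IsCompact K)
    (hz : ∀ t, z t ∈ K) (hw : weakNull z = ⊤) : Tendsto z atTop (𝓝 0) := by
  refine hK.le_nhds_of_unique_clusterPt (mem_map.2 (univ_mem' hz)) fun p _ hp => ?_
  have h1 : MapClusterPt p atTop z := hp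
  have h2 : MapClusterPt (inner ℂ p p) atTop ((fun y => inner ℂ p y) ∘ z) :=
    h1.continuousAt_comp (Continuous.inner continuous_const continuous_id).continuousAt
  have h3 : Tendsto ((fun y => inner ℂ p y) ∘ z) atTop (𝓝 0) :=
    mem_weakNull.1 (hw ▸ Submodule.mem_top : p ∈ weakNull z)
  have h4 : ClusterPt (inner ℂ p p) (𝓝 (0 : ℂ)) := ClusterPt.mono h2 h3
  exact inner_self_eq_zero.1 (eq_of_nhds_neBot h4)

variable {A : Z →ₗ.[ℂ] Z} {B : ℂ →L[ℂ] Z}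

theorem IsMinimal.eq_zero_of_inner_eq_zero
    (hmin : IsMinimal A B (ContinuousLinearMap.adjoint B) 0) {x : A.domain} {l : ℂ}
    (hx : A x = l • (x : Z)) (hb : inner ℂ (B 1) (x : Z) = 0) : (x : Z) = 0 := by
  by_contra hx0
  have hmem : l ∈ invariantZeros A B (ContinuousLinearMap.adjoint B) 0 ∩ RootLocus.spectrum A := by
    -- An eigenvector unseen by the output makes its eigenvalue an invariant zero with input `u =
    -- 0`.
    refine ⟨⟨x, 0, hx0, by simp [hx], ?_⟩, ?_⟩
    · rw [← ContinuousLinearMap.adjoint_inner_right] at hb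
      simpa using hb
    · rintro ⟨R, hR, -⟩
      have := hR x
      rw [hx, sub_self, map_zero] at this
      exact hx0 this.symm
  rw [hmin] at hmem
  exact hmem

namespace C0Semigroup

theorem IsGenerator.isContraction_closedLoop {T : C0Semigroup Z}
    (hT : T.IsGenerator (closedLoop A B (ContinuousLinearMap.adjoint B) k))
    (hA : Dense (A.domain : Set Z)) (hS : S.IsUnitary) (hSA : S.IsGenerator A) (hk : 0 ≤ k) :
    T.IsContraction := by
  intro t
  refine ContinuousLinearMap.opNorm_le_bound _ zero_le_one fun x => ?_
  rw [one_mul]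
  have key : ∀ x : A.domain, ‖T.toFun t x‖ ≤ ‖(x : Z)‖ := by
    intro x
    have h := (hT.isDampedFlow hS hSA x).norm_le hk le_rfl t.coe_nonneg
    simpa [hS.norm_adjoint_apply, T.map_zero] using h
  have hcl : IsClosed {x : Z | ‖T.toFun t x‖ ≤ ‖x‖} := isClosed_le (by fun_prop) (by fun_prop)
  exact (hA.closure_eq ▸ hcl.closure_subset_iff.2 fun y hy => key ⟨y, hy⟩) (Set.mem_univ x)

theorem IsGenerator.weakNull_eq_top {T : C0Semigroup Z}
    (hT : T.IsGenerator (closedLoop A B (ContinuousLinearMap.adjoint B) k))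
    (hsys : IsCollocatedSkewAdjoint A B (ContinuousLinearMap.adjoint B))
    (hmin : IsMinimal A B (ContinuousLinearMap.adjoint B) 0)
    (hS : S.IsUnitary) (hSA : S.IsGenerator A) (hk : 0 < k) (x : A.domain) :
    weakNull (fun t => T.toFun t (x : Z)) = ⊤ := by
  have hcon := hT.isContraction_closedLoop hsys.skewAdjoint.1 hS hSA hk.le
  have hv := hT.isDampedFlow hS hSA x
  set v : ℝ → Z := fun t => ContinuousLinearMap.adjoint (S.toFun t.toNNReal)
    (T.toFun t.toNNReal (x : Z)) with hvdef
  have hvT : ∀ t : ℝ≥0, T.toFun t (x : Z) = S.toFun t (v t) := fun t => by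
    simp only [hvdef, Real.toNNReal_coe, hS.apply_adjoint_apply]
  have hcl : IsClosed (weakNull (fun t => T.toFun t (x : Z)) : Set Z) :=
    isClosed_weakNull (C := ‖(x : Z)‖) fun t => by
      simpa using (T.toFun t).le_of_opNorm_le (hcon t) (x : Z)
  have htop : Tendsto (fun t : ℝ≥0 => (t : ℝ)) atTop atTop :=
    NNReal.tendsto_coe_atTop.2 tendsto_id
  have hshift : ∀ s : ℝ≥0, Tendsto (fun t : ℝ≥0 => T.toFun (t + s) (x : Z) -
      S.toFun s (T.toFun t (x : Z))) atTop (𝓝 0) := by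
    intro s
    have h1 := ((hv.tendsto_sub hk.le (hS.norm_adjointOrbit_le _) s.coe_nonneg).comp htop).norm
    rw [norm_zero] at h1
    refine tendsto_zero_iff_norm_tendsto_zero.2 (h1.congr fun t => ?_)
    rw [hvT, hvT, ← S.map_add_apply, add_comm s t, ← map_sub, hS.norm_apply]
    rfl
  refine hsys.system.eq_top_of_eigenvectors_mem hsys.skewAdjoint _ hcl fun y l hy => ?_
  refine eigenvector_mem_of_reducing (b := B 1) hSA hcl
    (fun s g hg => hS.mem_weakNull (hshift s) hg)
    (fun s g hg => adjoint_mem_weakNull (hshift s) hg) ?_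
    (fun y l hy hb => hmin.eq_zero_of_inner_eq_zero hy hb) hy
  rw [RootLocus.mem_weakNull]
  refine ((hv.tendsto_output hS hk).comp htop).congr fun t => ?_
  rw [Function.comp_apply, adjointOrbit, ContinuousLinearMap.adjoint_inner_left, hvT,
    Real.toNNReal_coe]

theorem IsGenerator.isStronglyStable_closedLoop {T : C0Semigroup Z}
    (hT : T.IsGenerator (closedLoop A B (ContinuousLinearMap.adjoint B) k))
    (hsys : IsCollocatedSkewAdjoint A B (ContinuousLinearMap.adjoint B))
    (hmin : IsMinimal A B (ContinuousLinearMap.adjoint B) 0)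
    (hS : S.IsUnitary) (hSA : S.IsGenerator A) (hk : 0 < k) : T.IsStronglyStable := by
  have hcon := hT.isContraction_closedLoop hsys.skewAdjoint.1 hS hSA hk.le
  have hle : ∀ t z, ‖T.toFun t z‖ ≤ ‖z‖ := fun t z => by
    simpa using (T.toFun t).le_of_opNorm_le (hcon t) z
  obtain ⟨s, R, hs, hR⟩ := hsys.system.exists_imaginary_resolvent hsys.skewAdjoint
  have hcomp := hsys.system.isCompactOperator_resolvent hsys.skewAdjoint hs hR
  have key : ∀ x : A.domain, Tendsto (fun t => T.toFun t (x : Z)) atTop (𝓝 0) := by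
    intro x
    set y := A x - (k : ℂ) • inner ℂ (B 1) (x : Z) • B 1 with hy
    have hxy : ∃ hx : (x : Z) ∈ (closedLoop A B (ContinuousLinearMap.adjoint B) k).domain,
        closedLoop A B (ContinuousLinearMap.adjoint B) k ⟨x, hx⟩ = y :=
      exists_closedLoop_apply_eq_iff.2 ⟨x.2, (sub_add_cancel _ _).symm⟩
    obtain ⟨hx, hxy⟩ := hxy
    -- `C` bounds `‖(s - A) T(t)x‖` uniformly in `t`, because `A T(t)x = T(t)y + k ⟨b, T(t)x⟩ b` and
    -- `T` is contractive.
    set C := ‖s‖ * ‖(x : Z)‖ + (‖y‖ + k * (‖B 1‖ * ‖(x : Z)‖ * ‖B 1‖)) with hC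
    obtain ⟨K, hK, hKsub⟩ := IsCompactOperator.image_closedBall_subset_compact
      (f := ((Complex.I • R : Z →L[ℂ] Z) : Z →ₗ[ℂ] Z)) hcomp C
    refine tendsto_zero_of_weakNull_eq_top hK (fun t => hKsub ?_)
      (hT.weakNull_eq_top hsys hmin hS hSA hk x)
    have h1 := hT.exists_apply_eq t ⟨x, hx⟩
    rw [hxy, exists_closedLoop_apply_eq_iff] at h1
    obtain ⟨hzd, hAz⟩ := h1
    have h2 := hR.left_inv ⟨_, hzd⟩
    -- The factor `-i` cancels the `i` in the compact operator `iR`, so the image is `R (s - A)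
    -- T(t)x = T(t)x`.
    refine ⟨-Complex.I • (s • T.toFun t (x : Z) - A ⟨_, hzd⟩), ?_, ?_⟩
    · rw [mem_closedBall_zero_iff, norm_smul, norm_neg, Complex.norm_I, one_mul, hAz]
      refine (norm_sub_le _ _).trans (add_le_add ?_ ((norm_add_le _ _).trans (add_le_add ?_ ?_)))
      · rw [norm_smul]
        gcongr
        exact hle _ _
      · exact hle _ _
      · rw [norm_smul, norm_smul, Complex.norm_real, Real.norm_of_nonneg hk.le]
        gcongr
        refine (norm_inner_le_norm _ _).trans ?_
        gcongr
        exact hle _ _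
    · simp only [ContinuousLinearMap.coe_coe, smul_apply, map_smul]
      rw [h2, smul_smul]
      simp
  intro z
  rw [Metric.tendsto_nhds]
  intro ε hε
  obtain ⟨x, hxd, hx⟩ := Metric.mem_closure_iff.1 (hsys.skewAdjoint.1 z) (ε / 2) (half_pos hε)
  filter_upwards [Metric.tendsto_nhds.1 (key ⟨x, hxd⟩) (ε / 2) (half_pos hε)] with t ht
  rw [dist_zero_right] at ht ⊢
  rw [dist_eq_norm] at hx
  have h1 : T.toFun t z = T.toFun t (z - x) + T.toFun t x := by rw [map_sub, sub_add_cancel]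
  rw [h1]
  refine (norm_add_le _ _).trans_lt ?_
  linarith [hle t (z - x)]

end C0Semigroup

end Stability

end RootLocus

theorem mainTheorem8 {Z : Type*} [NormedAddCommGroup Z] [InnerProductSpace ℂ Z] [CompleteSpace Z]
    (A : Z →ₗ.[ℂ] Z) (B : ℂ →L[ℂ] Z)
    (hsys : RootLocus.IsCollocatedSkewAdjoint A B (ContinuousLinearMap.adjoint B))
    (hmin : RootLocus.IsMinimal A B (ContinuousLinearMap.adjoint B) 0)
    (k : ℝ) (hk : 0 < k) :
    (∃ T : RootLocus.C0Semigroup Z,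
      T.IsGenerator (RootLocus.closedLoop A B (ContinuousLinearMap.adjoint B) k)) ∧
    ∀ T : RootLocus.C0Semigroup Z,
      T.IsGenerator (RootLocus.closedLoop A B (ContinuousLinearMap.adjoint B) k) →
        T.IsContraction ∧ T.IsStronglyStable := by
  obtain ⟨S, hSA⟩ := hsys.system.generator
  have hS := hsys.system.isUnitary hsys.skewAdjoint hSA
  exact ⟨hS.exists_isGenerator_closedLoop hSA hk.le, fun T hT =>
    ⟨hT.isContraction_closedLoop hsys.skewAdjoint.1 hS hSA hk.le,
      hT.isStronglyStable_closedLoop hsys hmin hS hSA hk⟩⟩
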